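/- Let $k$ be a field and let $A$ be a locally bounded $k$-category (for instance a basic finite-dimensional algebra over an algebraically closed field, viewed as a category whose object set $A_0$ is a fixed complete set of orthogonal primitive idempotents): distinct objects are not isomorphic, every $A(x,x)$ is local, every $A(x,y)$ is finite-dimensional, and for each $x$ only finitely many $y$ satisfy $A(x,y)\neq 0$ or $A(y,x)\neq 0$. Assume that $A$ has no nonzero oriented cycles, i.e. $A(x,x)=k\cdot\mathrm{id}_x\cong k$ for all $x\in A_0$. The repetitive category $\hat A$ has objects $x^{[i]}$ $(x\in A_0,\ i\in\mathbb Z)$ and morphisms $\hat A(x^{[i]},y^{[i]})=\{a^{[i]}\mid a\in A(x,y)\}$, $\hat A(x^{[i]},y^{[i+1]})=\{\beta^{[i]}\mid \beta\in D(A(y,x))\}$, where $D=\operatorname{Hom}_k(-,k)$, and $\hat A(x^{[i]},y^{[j]})=0$ otherwise; the composition is given by that of $A$ and by the bimodule structure of $DA$, products of two elements of $DA$ being zero. Let $A^{[i]}$ be the full subcategory on the objects $x^{[i]}$, $x\in A_0$. A ($k$-linear, strictly invertible) automorphism $\phi$ of $\hat A$ has jump $n\in\mathbb Z$ if $\phi(A^{[0]})=A^{[n]}$;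 then $\phi(A^{[i]})=A^{[i+n]}$ for all $i$, and $\phi_i\colon A\to A$ denotes the automorphism with $\phi(a^{[i]})=(\phi_i(a))^{[i+n]}$. Let $\phi,\psi$ be automorphisms of $\hat A$ with the same jump $n$ that coincide on the objects of $\hat A$, and let $i\in\mathbb Z$ (for example $i=0$). (1) Every map $\rho_0\colon A_0\to k^\times$ with $$\rho_0(y)\,\phi_i(a)=\psi_i(a)\,\rho_0(x)\qquad(a\in A(x,y),\ x,y\in A_0)\qquad(*)$$ extends to a map $\rho\colon \hat A_0\to k^\times$, i.e. $\rho(x^{[i]})=\rho_0(x)$ for all $x\in A_0$, such that $$\rho(v)\,\phi(f)=\psi(f)\,\rho(u)\qquad(f\in\hat A(u,v),\ u,v\in\hat A_0).$$ (2) For an automorphism $g$ of a $k$-category $C$ let $C/\langle g\rangle$ be the $\mathbb Z$-graded orbit category with the objects of $C$, morphisms $(C/\langle g\rangle)(x,y)=\bigoplus_{a\in\mathbb Z}C(g^a x,y)$, where $C(g^ax,y)$ is the part of degree $a$, and composition $h\cdot f=h\circ g^b(f)$ for $f\in C(g^ax,y)$, $h\in C(g^by,z)$. If a map $\rho_0$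 with $(*)$ exists, then there is a family $\eta=(\eta_a)_{a\in\mathbb Z}$ of natural isomorphisms $\eta_a\colon\psi^a\Rightarrow\phi^a$ such that $(\mathrm{id}_{\hat A},\eta)\colon(\hat A,\phi)\to(\hat A,\psi)$ is $\mathbb Z$-equivariant, i.e. $\eta_{b+a,x}=\eta_{b,\phi^a x}\circ\psi^b(\eta_{a,x})$, and such that the induced functor $(\mathrm{id}_{\hat A},\eta)/\mathbb Z\colon\hat A/\langle\phi\rangle\to\hat A/\langle\psi\rangle$, which is the identity on objects and sends $f\in\hat A(\phi^a x,y)$ to $f\circ\eta_{a,x}$, is an equivalence in the 2-category of $\mathbb Z$-graded categories, degree-preserving functors and their morphisms. (A degree-preserving functor is a $k$-linear functor $H$ with a map $r$ from objects to $\mathbb Z$ such that $H$ sends degree $r_y+a$ in $(x,y)$ to degree $a+r_x$ in $(Hx,Hy)$; a morphism $(H,r)\Rightarrow(I,s)$ is a natural transformation $\theta$ with $\theta_x$ of degree $-s_x+r_x$.) If moreover $n\neq0$, then this functor is an isomorphism of $\mathbb Z$-graded categories, and the same holds for the classical orbit categories, whose objects are the orbits in $\hat A_0$ and whose morphisms $X\to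 Y$ are the families $(f_{v,u}\in\hat A(u,v))_{u\in X,v\in Y}$ commuting with the action: for every choice $T$ of representatives of the orbits, the degree-$a$ parts with respect to $T$ (the families with nonzero entries only at the pairs $(u,v)=(g^{c+a}x,g^{c}y)$, $c\in\mathbb Z$, where $g=\phi$ or $\psi$ and $x,y\in T$ represent $X,Y$) are $\mathbb Z$-gradings, and there is a degree-preserving isomorphism $H$ (with $r=0$) between the classical orbit categories of $\phi$ and $\psi$ that is the identity on orbits and is induced by $(\mathrm{id}_{\hat A},\eta)$: $H(f)_{y,\psi^a x}=f_{y,\phi^a x}\circ\eta_{a,x}$ for $x,y\in T$, $a\in\mathbb Z$. -/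

import Mathlib

open CategoryTheory DirectSum

attribute [-instance] CategoryTheory.catToReflQuiver

noncomputable section

namespace GME

universe w v u v' u'

section Basic

variable (k : Type w) [Field k] (C : Type u) [Category.{v} C] [Preadditive C] [Linear k C]

/-- Locally bounded `k`-linear categories. -/
structure IsLocallyBounded : Prop where
  eq_of_iso : ∀ x y : C, Nonempty (x ≅ y) → x = y
  isLocalRing_end : ∀ x : C, IsLocalRing (End x)
  finite_hom : ∀ x y : C, Module.Finite k (x ⟶ y)
  finite_neighbours : ∀ x : C, {y : C | (∃ f : x ⟶ y, f ≠ 0) ∨ (∃ f : y ⟶ x, f ≠ 0)}.Finite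

/-- `C(x, x) = k` for every object `x`. -/
def NoNonzeroOrientedCycles : Prop :=
  ∀ x : C, Function.Bijective (fun c : k => c • 𝟙 x)

/-- Automorphisms of the `k`-linear category `C`: strictly invertible `k`-linear functors. -/
structure LinAut where
  functor : C ⥤ C
  inverse : C ⥤ C
  functor_inverse : functor ⋙ inverse = 𝟭 C
  inverse_functor : inverse ⋙ functor = 𝟭 C
  map_add : ∀ {x y : C} (f g : x ⟶ y), functor.map (f + g) = functor.map f + functor.map g
  map_smul : ∀ {x y : C} (c : k) (f : x ⟶ y), functor.map (c • f) = c • functor.map f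

end Basic

section Aut

variable {k : Type w} [Field k] {C : Type u} [Category.{v} C] [Preadditive C] [Linear k C]

namespace LinAut

theorem ext_functor {g h : LinAut k C} (H : g.functor = h.functor) : g = h := by
  have H' : g.inverse = h.inverse := by
    calc g.inverse = g.inverse ⋙ (h.functor ⋙ h.inverse) := by
          rw [h.functor_inverse]; rfl
      _ = (g.inverse ⋙ g.functor) ⋙ h.inverse := by rw [H]; rfl
      _ = h.inverse := by rw [g.inverse_functor]; rfl
  cases g; cases h; cases H; cases H'; rfl

theorem map_injective (g : LinAut k C) {x y : C} {f f' : x ⟶ y}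
    (H : g.functor.map f = g.functor.map f') : f = f' := by
  have h1 := Functor.congr_hom g.functor_inverse f
  have h2 := Functor.congr_hom g.functor_inverse f'
  simp only [Functor.comp_map, Functor.id_map] at h1 h2
  rw [H, h2] at h1
  exact (cancel_epi _).1 ((cancel_mono _).1 (by simpa only [Category.assoc] using h1.symm))

instance : One (LinAut k C) :=
  ⟨{ functor := 𝟭 C, inverse := 𝟭 C, functor_inverse := rfl, inverse_functor := rfl
     map_add := fun _ _ => rfl, map_smul := fun _ _ => rfl }⟩

/-- The product of automorphisms is composition: `(g * h)(x) = g (h x)`. -/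
instance : Mul (LinAut k C) :=
  ⟨fun g h =>
    { functor := h.functor ⋙ g.functor
      inverse := g.inverse ⋙ h.inverse
      functor_inverse := by
        change h.functor ⋙ (g.functor ⋙ g.inverse) ⋙ h.inverse = _
        rw [g.functor_inverse]; exact h.functor_inverse
      inverse_functor := by
        change g.inverse ⋙ (h.inverse ⋙ h.functor) ⋙ g.functor = _
        rw [h.inverse_functor]; exact g.inverse_functor
      map_add := fun f f' => by simp [h.map_add, g.map_add]
      map_smul := fun c f => by simp [h.map_smul, g.map_smul] }⟩

instance : Inv (LinAut k C) :=
  ⟨fun g =>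
    { functor := g.inverse
      inverse := g.functor
      functor_inverse := g.inverse_functor
      inverse_functor := g.functor_inverse
      map_add := fun f f' => by
        apply g.map_injective
        have h {x y : C} (l : x ⟶ y) := Functor.congr_hom g.inverse_functor l
        simp only [Functor.comp_map, Functor.id_map] at h
        rw [g.map_add, h, h f, h f']; simp
      map_smul := fun c f => by
        apply g.map_injective
        have h {x y : C} (l : x ⟶ y) := Functor.congr_hom g.inverse_functor l
        simp only [Functor.comp_map, Functor.id_map] at h
        rw [g.map_smul, h, h f]; simp }⟩

instance : Group (LinAut k C) :=
  Group.ofLeftAxioms (fun _ _ _ => ext_functor rfl) (fun _ => ext_functor rfl)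
    (fun g => ext_functor g.functor_inverse)

/-- The `ℤ`-action generated by `g`: the functor `g ^ a`. -/
def act (g : LinAut k C) (a : ℤ) : C ⥤ C := (g ^ a).functor

theorem act_zero (g : LinAut k C) : g.act 0 = 𝟭 C := by
  unfold act; rw [zpow_zero]; rfl

theorem act_add (g : LinAut k C) (a b : ℤ) : g.act (a + b) = g.act b ⋙ g.act a := by
  unfold act; rw [zpow_add]; rfl

theorem act_zero_obj (g : LinAut k C) (x : C) : (g.act 0).obj x = x :=
  Functor.congr_obj g.act_zero x

theorem act_add_obj (g : LinAut k C) (a b : ℤ) (x : C) :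
    (g.act (a + b)).obj x = (g.act a).obj ((g.act b).obj x) :=
  Functor.congr_obj (g.act_add a b) x

instance (g : LinAut k C) (a : ℤ) : (g.act a).Additive := ⟨fun {_ _ f f'} => (g ^ a).map_add f f'⟩

instance (g : LinAut k C) (a : ℤ) : (g.act a).Linear k := ⟨fun f c => (g ^ a).map_smul c f⟩

end LinAut

end Aut

section Repetitive

/-- Objects of the repetitive category `Â` of the `k`-linear category `A`: `⟨x, i⟩` is `x^{[i]}`. -/
structure Repetitive (k : Type w) (A : Type u) where
  obj : A
  lvl : ℤ

variable (k : Type w) [Field k] (A : Type u) [Category.{v} A] [Preadditive A] [Linear k A]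

namespace Repetitive

variable {k A}

/-- Morphisms `x^{[i]} ⟶ y^{[j]}`: pairs `(f, β)` with `f ∈ A(x, y)` and `β ∈ D A(y, x)`, where
`f = 0` unless `j = i`, and `β = 0` unless `j = i + 1`.  So this is `A(x, y)` for `j = i`,
`D A(y, x)` for `j = i + 1`, and `0` otherwise. -/
def homs (X Y : Repetitive k A) :
    Submodule k ((X.obj ⟶ Y.obj) × Module.Dual k (Y.obj ⟶ X.obj)) where
  carrier := {p | (Y.lvl ≠ X.lvl → p.1 = 0) ∧ (Y.lvl ≠ X.lvl + 1 → p.2 = 0)}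
  add_mem' := fun {p q} hp hq =>
    ⟨fun h => by simp [hp.1 h, hq.1 h], fun h => by simp [hp.2 h, hq.2 h]⟩
  zero_mem' := ⟨fun _ => rfl, fun _ => rfl⟩
  smul_mem' := fun c p hp => ⟨fun h => by simp [hp.1 h], fun h => by simp [hp.2 h]⟩

/-- Composition: the composition of `A`, together with the bimodule structure of `D A`;
the product of two elements of `D A` is zero. -/
def compPair {x y z : A} (p : (x ⟶ y) × Module.Dual k (y ⟶ x))
    (q : (y ⟶ z) × Module.Dual k (z ⟶ y)) : (x ⟶ z) × Module.Dual k (z ⟶ x) :=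
  (p.1 ≫ q.1, q.2 ∘ₗ Linear.rightComp k z p.1 + p.2 ∘ₗ Linear.leftComp k x q.1)

theorem compPair_mem {X Y Z : Repetitive k A} {p : (X.obj ⟶ Y.obj) × Module.Dual k (Y.obj ⟶ X.obj)}
    {q : (Y.obj ⟶ Z.obj) × Module.Dual k (Z.obj ⟶ Y.obj)} (hp : p ∈ homs X Y) (hq : q ∈ homs Y Z) :
    compPair p q ∈ homs X Z := by
  constructor
  · intro h
    by_cases h1 : Y.lvl = X.lvl
    · simp [compPair, hq.1 (by omega)]
    · simp [compPair, hp.1 h1]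
  · intro h
    have e1 : q.2 ∘ₗ Linear.rightComp k Z.obj p.1 = 0 := by
      by_cases h1 : Y.lvl = X.lvl
      · simp [hq.2 (by omega)]
      · ext a; simp [hp.1 h1]
    have e2 : p.2 ∘ₗ Linear.leftComp k X.obj q.1 = 0 := by
      by_cases h1 : Y.lvl = X.lvl + 1
      · ext a; simp [hq.1 (by omega)]
      · simp [hp.2 h1]
    simp [compPair, e1, e2]

instance : Category (Repetitive k A) where
  Hom X Y := homs X Y
  id X := ⟨(𝟙 X.obj, 0), ⟨fun h => absurd rfl h, fun _ => rfl⟩⟩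
  comp f g := ⟨compPair f.1 g.1, compPair_mem f.2 g.2⟩
  id_comp f := by
    apply Subtype.ext
    refine Prod.ext (Category.id_comp _) ?_
    ext a; simp [compPair]
  comp_id f := by
    apply Subtype.ext
    refine Prod.ext (Category.comp_id _) ?_
    ext a; simp [compPair]
  assoc f g h := by
    apply Subtype.ext
    refine Prod.ext (Category.assoc _ _ _) ?_
    ext a; simp [compPair, add_assoc]

instance : Preadditive (Repetitive k A) where
  homGroup X Y := inferInstanceAs (AddCommGroup (homs X Y))
  add_comp _ _ _ f f' g := by
    apply Subtype.ext
    refine Prod.ext (Preadditive.add_comp _ _ _ _ _ _) ?_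
    change (compPair (f.1 + f'.1) g.1).2 = (compPair f.1 g.1).2 + (compPair f'.1 g.1).2
    ext a; simp [compPair]; abel
  comp_add _ _ _ f g g' := by
    apply Subtype.ext
    refine Prod.ext (Preadditive.comp_add _ _ _ _ _ _) ?_
    change (compPair f.1 (g.1 + g'.1)).2 = (compPair f.1 g.1).2 + (compPair f.1 g'.1).2
    ext a; simp [compPair]; abel

instance : Linear k (Repetitive k A) where
  homModule X Y := inferInstanceAs (Module k (homs X Y))
  smul_comp _ _ _ c f g := by
    apply Subtype.ext
    refine Prod.ext (Linear.smul_comp _ _ _ _ _ _) ?_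
    change (compPair (c • f.1) g.1).2 = c • (compPair f.1 g.1).2
    ext a; simp [compPair]
  comp_smul _ _ _ f c g := by
    apply Subtype.ext
    refine Prod.ext (Linear.comp_smul _ _ _ _ _ _) ?_
    change (compPair f.1 (c • g.1)).2 = c • (compPair f.1 g.1).2
    ext a; simp [compPair]

variable (k A)

/-- The inclusion `id^{[i]} : A ⥤ Â`, an isomorphism onto the full subcategory `A^{[i]}`. -/
def incl (i : ℤ) : A ⥤ Repetitive k A where
  obj x := ⟨x, i⟩
  map f := ⟨(f, 0), ⟨fun h => absurd rfl h, fun _ => rfl⟩⟩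
  map_comp f g := by
    apply Subtype.ext
    refine Prod.ext rfl ?_
    change (0 : Module.Dual k _) = 0 ∘ₗ _ + 0 ∘ₗ _
    simp

/-- The functor `Â ⥤ A` with `x^{[i]} ↦ x`, `f^{[i]} ↦ f` and `β^{[i]} ↦ 0`.  On each `A^{[i]}` it is
the inverse of `id^{[i]}`. -/
def proj : Repetitive k A ⥤ A where
  obj X := X.obj
  map f := f.1.1

variable {k A}

/-- `φ` has jump `n`: `φ(A^{[0]}) = A^{[n]}` (equality of full subcategories). -/
def HasJump (φ : LinAut k (Repetitive k A)) (n : ℤ) : Prop :=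
  φ.functor.obj '' {X | X.lvl = 0} = {X | X.lvl = n}

/-- For `φ` with jump `n`, the functor `φ_i = (id^{[i+n]})⁻¹ φ id^{[i]} : A ⥤ A`, that is,
`φ(a^{[i]}) = φ_i(a)^{[i+n]}`. -/
def level (φ : LinAut k (Repetitive k A)) (i : ℤ) : A ⥤ A :=
  incl k A i ⋙ φ.functor ⋙ proj k A

end Repetitive

end Repetitive

section Intertwine

variable {k : Type w} [Field k] {C : Type u} [Category.{v} C]
  {D : Type u'} [Category.{v'} D] [Preadditive D] [Linear k D]

/-- `ρ(y) F(f) = G(f) ρ(x)` for all `f : x ⟶ y`, for functors `F, G` that coincide on objects. -/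
def Intertwines (F G : C ⥤ D) (h : ∀ x, F.obj x = G.obj x) (ρ : C → kˣ) : Prop :=
  ∀ ⦃x y : C⦄ (f : x ⟶ y),
    (ρ y : k) • F.map f = eqToHom (h x) ≫ ((ρ x : k) • G.map f) ≫ eqToHom (h y).symm

end Intertwine

section Graded

/-- `ℤ`-gradings of a `k`-linear category. -/
structure Grading (k : Type w) [Field k] (B : Type u) [Category.{v} B] [Preadditive B]
    [Linear k B] where
  deg : ℤ → ∀ x y : B, Submodule k (x ⟶ y)
  isInternal : ∀ x y : B, DirectSum.IsInternal fun a => deg a x y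
  comp_mem : ∀ {x y z : B} {a b : ℤ} {f : x ⟶ y} {g : y ⟶ z},
    f ∈ deg a x y → g ∈ deg b y z → f ≫ g ∈ deg (b + a) x z

variable {k : Type w} [Field k] {B : Type u} [Category.{v} B] [Preadditive B] [Linear k B]
  {B' : Type u'} [Category.{v'} B'] [Preadditive B'] [Linear k B']
  {B'' : Type*} [Category B''] [Preadditive B''] [Linear k B'']

/-- Degree-preserving functors `(H, r)` between `ℤ`-graded categories. -/
@[ext]
structure GrFunctor (𝒜 : Grading k B) (ℬ : Grading k B') where
  functor : B ⥤ B'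
  adjuster : B → ℤ
  additive : functor.Additive
  linear : functor.Linear k
  map_mem : ∀ {x y : B} (a : ℤ) (f : x ⟶ y), f ∈ 𝒜.deg (adjuster y + a) x y →
    functor.map f ∈ ℬ.deg (a + adjuster x) (functor.obj x) (functor.obj y)

namespace GrFunctor

/-- The identity degree-preserving functor. -/
def id (𝒜 : Grading k B) : GrFunctor 𝒜 𝒜 where
  functor := 𝟭 B
  adjuster := fun _ => 0
  additive := inferInstance
  linear := inferInstance
  map_mem a f hf := by simpa using hf

variable {𝒜 : Grading k B} {ℬ : Grading k B'} {𝒞 : Grading k B''}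

/-- First `H`, then `K`; the degree adjuster is `x ↦ r_x + r'_{H x}`. -/
def comp (H : GrFunctor 𝒜 ℬ) (K : GrFunctor ℬ 𝒞) : GrFunctor 𝒜 𝒞 where
  functor := H.functor ⋙ K.functor
  adjuster := fun x => H.adjuster x + K.adjuster (H.functor.obj x)
  additive := by
    have := H.additive; have := K.additive; infer_instance
  linear := by
    have := H.linear; have := K.linear; infer_instance
  map_mem {x y} a f hf := by
    have h1 := H.map_mem (K.adjuster (H.functor.obj y) + a) f (by rwa [← add_assoc])
    have h2 := K.map_mem (a + H.adjuster x) (H.functor.map f) (by rwa [← add_assoc])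
    simpa [add_assoc] using h2

/-- Morphisms of degree-preserving functors `(H, r) ⇒ (I, s)`: `θ_x` has degree `s_x⁻¹ r_x`. -/
def IsMorphism (H I : GrFunctor 𝒜 ℬ) (θ : H.functor ⟶ I.functor) : Prop :=
  ∀ x : B, θ.app x ∈ ℬ.deg (-I.adjuster x + H.adjuster x) (H.functor.obj x) (I.functor.obj x)

/-- `H` and `I` are isomorphic in the category of degree-preserving functors. -/
def Isomorphic (H I : GrFunctor 𝒜 ℬ) : Prop :=
  ∃ θ : H.functor ≅ I.functor, IsMorphism H I θ.hom ∧ IsMorphism I H θ.inv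

/-- Equivalences in the 2-category of `ℤ`-graded categories. -/
def IsGrEquivalence (H : GrFunctor 𝒜 ℬ) : Prop :=
  ∃ K : GrFunctor ℬ 𝒜, Isomorphic (H.comp K) (GrFunctor.id 𝒜) ∧
    Isomorphic (K.comp H) (GrFunctor.id ℬ)

/-- Isomorphisms of `ℤ`-graded categories. -/
def IsGrIsomorphism (H : GrFunctor 𝒜 ℬ) : Prop :=
  ∃ K : GrFunctor ℬ 𝒜, H.comp K = GrFunctor.id 𝒜 ∧ K.comp H = GrFunctor.id ℬ

end GrFunctor

end Graded

section Orbit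

theorem eq_eqToHom_of_idem {D : Type u'} [Category.{v'} D] {a b : D} (p : a = b) (e : a ≅ b)
    (H : e.hom = e.hom ≫ eqToHom p.symm ≫ e.hom) : e.hom = eqToHom p := by
  subst p
  have H' : e.hom ≫ e.hom = e.hom ≫ 𝟙 _ := by simpa using H.symm
  simpa using (cancel_epi e.hom).1 H'

variable {k : Type w} [Field k] {C : Type u} [Category.{v} C] [Preadditive C] [Linear k C]
  {D : Type u'} [Category.{v'} D] [Preadditive D] [Linear k D]

/-- The orbit category `C/⟨g⟩` of a (not necessarily free) `ℤ`-action: it has the objects of `C`. -/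
structure OrbitCat (g : LinAut k C) where
  as : C

namespace OrbitCat

/-- `(C/⟨g⟩)(x, y) = ⨁ₐ C(gᵃ x, y)`. -/
abbrev Homs (g : LinAut k C) (x y : C) : Type v := ⨁ a : ℤ, ((g.act a).obj x ⟶ y)

/-- The morphism of degree `a` given by `f ∈ C(gᵃ x, y)`. -/
abbrev single (g : LinAut k C) {x y : C} (a : ℤ) : ((g.act a).obj x ⟶ y) →ₗ[k] Homs g x y :=
  DirectSum.lof k ℤ (fun a : ℤ => ((g.act a).obj x ⟶ y)) a

/-- For `f ∈ C(gᵃ x, y)` and `h ∈ C(gᵇ y, z)`, the morphism `h ∘ gᵇ(f) ∈ C(gᵇ⁺ᵃ x, z)`. -/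
def compHom (g : LinAut k C) (x y z : C) (a b : ℤ) :
    ((g.act a).obj x ⟶ y) →ₗ[k] ((g.act b).obj y ⟶ z) →ₗ[k] ((g.act (b + a)).obj x ⟶ z) :=
  LinearMap.mk₂ k (fun f h => eqToHom (g.act_add_obj b a x) ≫ (g.act b).map f ≫ h)
    (by intros; simp [Functor.map_add]) (by intros; simp [Functor.map_smul])
    (by intros; simp) (by intros; simp)

theorem compHom_apply (g : LinAut k C) {x y z : C} {a b : ℤ} (f : (g.act a).obj x ⟶ y)
    (h : (g.act b).obj y ⟶ z) :
    compHom g x y z a b f h = eqToHom (g.act_add_obj b a x) ≫ (g.act b).map f ≫ h := rfl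

/-- Composition in the orbit category, the bilinear extension of `compHom`. -/
def compMap (g : LinAut k C) (x y z : C) : Homs g x y →ₗ[k] Homs g y z →ₗ[k] Homs g x z :=
  DirectSum.toModule k ℤ _ fun a => LinearMap.flip <| DirectSum.toModule k ℤ _ fun b =>
    LinearMap.flip <| (compHom g x y z a b).compr₂ (single g (b + a))

theorem compMap_single (g : LinAut k C) {x y z : C} {a b : ℤ} (f : (g.act a).obj x ⟶ y)
    (h : (g.act b).obj y ⟶ z) :
    compMap g x y z (single g a f) (single g b h) = single g (b + a) (compHom g x y z a b f h) := by
  simp [compMap, single]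

theorem single_congr (g : LinAut k C) {x y : C} {a b : ℤ} (e : b = a) (f : (g.act a).obj x ⟶ y) :
    single g a f = single g b (eqToHom (by rw [e]) ≫ f) := by
  subst e; simp

/-- The identity of `x`. -/
def idHom (g : LinAut k C) (x : C) : Homs g x x := single g 0 (eqToHom (g.act_zero_obj x))

theorem id_compMap (g : LinAut k C) (x y : C) :
    compMap g x x y (idHom g x) = LinearMap.id := by
  apply DirectSum.linearMap_ext
  intro b
  ext h
  simp only [LinearMap.comp_apply, LinearMap.id_apply, idHom]
  rw [compMap_single, single_congr g (add_zero b) h, compHom_apply]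
  simp [eqToHom_map]

theorem compMap_id (g : LinAut k C) (x y : C) :
    (compMap g x y y).flip (idHom g y) = LinearMap.id := by
  apply DirectSum.linearMap_ext
  intro a
  ext f
  simp only [LinearMap.comp_apply, LinearMap.id_apply, idHom, LinearMap.flip_apply]
  rw [compMap_single, single_congr g (zero_add a) f, compHom_apply]
  have h := Functor.congr_hom g.act_zero f
  simp only [Functor.id_map] at h
  rw [h]
  simp

theorem compMap_assoc (g : LinAut k C) {x y z t : C} (f : Homs g x y) (h : Homs g y z)
    (l : Homs g z t) :
    compMap g x z t (compMap g x y z f h) l = compMap g x y t f (compMap g y z t h l) := by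
  induction f using DirectSum.induction_on with
  | zero => simp
  | add f f' h1 h2 => simp only [map_add, LinearMap.add_apply, h1, h2]
  | of a f =>
    induction h using DirectSum.induction_on with
    | zero => simp
    | add f f' h1 h2 => simp only [map_add, LinearMap.add_apply, h1, h2]
    | of b h =>
      induction l using DirectSum.induction_on with
      | zero => simp
      | add f f' h1 h2 => simp only [map_add, h1, h2]
      | of c l =>
        simp only [← DirectSum.lof_eq_of k]
        rw [compMap_single, compMap_single, compMap_single, compMap_single,
          single_congr g (add_assoc c b a)]
        have e := Functor.congr_hom (g.act_add c b) f
        simp only [Functor.comp_map] at e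
        simp only [compHom_apply, e, Functor.map_comp, eqToHom_map, Category.assoc,
          eqToHom_trans_assoc, eqToHom_refl, Category.id_comp]

instance (g : LinAut k C) : Category (OrbitCat g) where
  Hom X Y := Homs g X.as Y.as
  id X := idHom g X.as
  comp f h := compMap g _ _ _ f h
  id_comp {X Y} f := LinearMap.congr_fun (id_compMap g X.as Y.as) f
  comp_id {X Y} f := LinearMap.congr_fun (compMap_id g X.as Y.as) f
  assoc f h l := compMap_assoc g f h l

instance (g : LinAut k C) : Preadditive (OrbitCat g) where
  homGroup X Y := inferInstanceAs (AddCommGroup (Homs g X.as Y.as))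
  add_comp X Y Z f f' h := LinearMap.map_add₂ (compMap g X.as Y.as Z.as) f f' h
  comp_add X Y Z f h h' := (compMap g X.as Y.as Z.as f).map_add h h'

instance (g : LinAut k C) : Linear k (OrbitCat g) where
  homModule X Y := inferInstanceAs (Module k (Homs g X.as Y.as))
  smul_comp X Y Z c f h := LinearMap.map_smul₂ (compMap g X.as Y.as Z.as) c f h
  comp_smul X Y Z f c h := (compMap g X.as Y.as Z.as f).map_smul c h

/-- The `ℤ`-grading of the orbit category: `(C/⟨g⟩)ᵃ(x, y) = C(gᵃ x, y)`. -/
def grading (g : LinAut k C) : Grading k (OrbitCat g) where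
  deg a X Y := LinearMap.range (single g (x := X.as) (y := Y.as) a)
  isInternal X Y := by
    let r := fun a : ℤ => (single g (x := X.as) (y := Y.as) a).rangeRestrict
    have h1 : ∀ f, DirectSum.coeLinearMap
        (fun a : ℤ => LinearMap.range (single g (x := X.as) (y := Y.as) a))
        (DirectSum.lmap r f) = f := by
      intro f
      have : (DirectSum.coeLinearMap
        (fun a : ℤ => LinearMap.range (single g (x := X.as) (y := Y.as) a))) ∘ₗ
        (DirectSum.lmap r) = LinearMap.id := by
        apply DirectSum.linearMap_ext
        intro a
        ext f
        simp [r]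
      exact LinearMap.congr_fun this f
    have h2 : Function.Surjective (DirectSum.lmap r) :=
      (DirectSum.lmap_surjective _).2 fun a => LinearMap.surjective_rangeRestrict _
    refine ⟨?_, fun f => ⟨_, h1 f⟩⟩
    intro p q hpq
    obtain ⟨p, rfl⟩ := h2 p
    obtain ⟨q, rfl⟩ := h2 q
    have hpq' : p = q := by
      rw [← h1 p, ← h1 q]; exact hpq
    rw [hpq']
  comp_mem := by
    rintro X Y Z a b _ _ ⟨f, rfl⟩ ⟨h, rfl⟩
    exact ⟨_, (compMap_single g f h).symm⟩

end OrbitCat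

/-- The second component `η` of a `ℤ`-equivariant functor `(F, η) : (C, g) ⟶ (D, h)`: natural
isomorphisms `ηₐ : hᵃ F ⇒ F gᵃ` with `η_{b+a} = (η_b gᵃ) ∘ (hᵇ ηₐ)`. -/
structure Equivariance (g : LinAut k C) (h : LinAut k D) (F : C ⥤ D) where
  iso : ∀ a : ℤ, F ⋙ h.act a ≅ g.act a ⋙ F
  iso_add : ∀ (b a : ℤ) (x : C), (iso (b + a)).hom.app x =
    eqToHom (h.act_add_obj b a (F.obj x)) ≫ (h.act b).map ((iso a).hom.app x) ≫
      (iso b).hom.app ((g.act a).obj x) ≫ eqToHom (congrArg F.obj (g.act_add_obj b a x).symm)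

namespace Equivariance

variable {g : LinAut k C} {h : LinAut k D} {F : C ⥤ D}

theorem iso_congr (η : Equivariance g h F) {a b : ℤ} (e : a = b) (x : C) :
    (η.iso a).hom.app x = eqToHom (by rw [e]) ≫ (η.iso b).hom.app x ≫ eqToHom (by rw [e]) := by
  subst e; simp

theorem app_congr (η : Equivariance g h F) (a : ℤ) {x y : C} (e : x = y) :
    (η.iso a).hom.app x = eqToHom (by rw [e]) ≫ (η.iso a).hom.app y ≫ eqToHom (by rw [e]) := by
  subst e; simp

theorem iso_zero (η : Equivariance g h F) (x : C) : (η.iso 0).hom.app x =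
    eqToHom (by simp [LinAut.act_zero_obj]) := by
  refine eq_eqToHom_of_idem _ ((η.iso 0).app x) ?_
  have H := η.iso_add 0 0 x
  rw [η.iso_congr (add_zero 0), η.app_congr 0 (g.act_zero_obj x)] at H
  have h1 := Functor.congr_hom h.act_zero ((η.iso 0).hom.app x)
  simp only [Functor.id_map] at h1
  rw [h1] at H
  simp only [Category.assoc, eqToHom_trans, eqToHom_trans_assoc] at H
  have H2 := (cancel_epi _).1 H
  simp only [← Category.assoc] at H2
  have H3 := (cancel_mono _).1 H2
  simpa using H3

variable [F.Additive] [F.Linear k]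

/-- The map `C(gᵃ x, y) ∋ f ↦ F(f) ∘ η_{a,x} ∈ D(hᵃ F x, F y)` on homogeneous components. -/
def orbitComponent (η : Equivariance g h F) (x y : C) (a : ℤ) :
    ((g.act a).obj x ⟶ y) →ₗ[k] ((h.act a).obj (F.obj x) ⟶ F.obj y) :=
  Linear.leftComp k (F.obj y) ((η.iso a).hom.app x) ∘ₗ F.mapLinearMap k

theorem orbitComponent_apply (η : Equivariance g h F) {x y : C} {a : ℤ}
    (f : (g.act a).obj x ⟶ y) :
    η.orbitComponent x y a f = (η.iso a).hom.app x ≫ F.map f := rfl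

theorem lmap_compMap (η : Equivariance g h F) {x y z : C} (f : OrbitCat.Homs g x y)
    (l : OrbitCat.Homs g y z) :
    DirectSum.lmap (η.orbitComponent x z) (OrbitCat.compMap g x y z f l) =
      OrbitCat.compMap h (F.obj x) (F.obj y) (F.obj z) (DirectSum.lmap (η.orbitComponent x y) f)
        (DirectSum.lmap (η.orbitComponent y z) l) := by
  induction f using DirectSum.induction_on with
  | zero => simp
  | add f f' h1 h2 => simp only [map_add, LinearMap.add_apply, h1, h2]
  | of a f =>
    induction l using DirectSum.induction_on with
    | zero => simp
    | add f f' h1 h2 => simp only [map_add, h1, h2]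
    | of b l =>
      simp only [← DirectSum.lof_eq_of k]
      rw [OrbitCat.compMap_single, DirectSum.lmap_lof, DirectSum.lmap_lof, DirectSum.lmap_lof,
        OrbitCat.compMap_single]
      congr 1
      have e := (η.iso b).hom.naturality f
      simp only [Functor.comp_map] at e
      simp only [orbitComponent_apply, OrbitCat.compHom_apply, η.iso_add, Functor.map_comp,
        Category.assoc, eqToHom_map, eqToHom_trans_assoc, eqToHom_refl, Category.id_comp]
      rw [reassoc_of% e]

/-- The functor `(F, η)/ℤ : C/⟨g⟩ ⥤ D/⟨h⟩`. -/
def orbitFunctor (η : Equivariance g h F) : OrbitCat g ⥤ OrbitCat h where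
  obj X := ⟨F.obj X.as⟩
  map {X Y} f := DirectSum.lmap (η.orbitComponent X.as Y.as) f
  map_id X := by
    change DirectSum.lmap _ (OrbitCat.idHom g X.as) = OrbitCat.idHom h (F.obj X.as)
    simp only [OrbitCat.idHom, OrbitCat.single, DirectSum.lmap_lof, orbitComponent_apply,
      η.iso_zero, eqToHom_map, eqToHom_trans]
  map_comp {X Y Z} f l := by
    change DirectSum.lmap _ (OrbitCat.compMap g _ _ _ f l) =
      OrbitCat.compMap h _ _ _ (DirectSum.lmap _ f) (DirectSum.lmap _ l)
    exact η.lmap_compMap f l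

/-- `(F, η)/ℤ` as a strictly degree-preserving functor. -/
def orbitGrFunctor (η : Equivariance g h F) :
    GrFunctor (OrbitCat.grading g) (OrbitCat.grading h) where
  functor := η.orbitFunctor
  adjuster := fun _ => 0
  additive := ⟨fun {X Y f f'} => map_add (DirectSum.lmap (η.orbitComponent X.as Y.as)) f f'⟩
  linear := ⟨fun {X Y} f c => map_smul (DirectSum.lmap (η.orbitComponent X.as Y.as)) c f⟩
  map_mem {X Y} a f hf := by
    rw [zero_add] at hf
    rw [add_zero]
    obtain ⟨f, rfl⟩ := hf
    exact ⟨η.orbitComponent X.as Y.as a f, (DirectSum.lmap_lof (η.orbitComponent X.as Y.as) a f).symm⟩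

end Equivariance

end Orbit

section Classical

variable {k : Type w} [Field k] {C : Type u} [Category.{v} C] [Preadditive C] [Linear k C]

/-- Two objects are equivalent if they lie in the same orbit of the action of `g`. -/
def orbitSetoid (g : LinAut k C) : Setoid C where
  r x y := ∃ m : ℤ, (g.act m).obj x = y
  iseqv :=
    { refl := fun x => ⟨0, g.act_zero_obj x⟩
      symm := by
        rintro x _ ⟨m, rfl⟩
        exact ⟨-m, by rw [← g.act_add_obj, neg_add_cancel, g.act_zero_obj]⟩
      trans := by
        rintro x _ _ ⟨m, rfl⟩ ⟨l, rfl⟩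
        exact ⟨l + m, g.act_add_obj l m x⟩ }

/-- The classical orbit category `C/⟨g⟩` of a free action on a locally bounded category:
its objects are the orbits of objects. -/
structure ClassicalOrbit (g : LinAut k C) where
  orbit : Quotient (orbitSetoid g)

namespace ClassicalOrbit

/-- The orbit of the object `x`. -/
def mk' (g : LinAut k C) (x : C) : ClassicalOrbit g := ⟨Quotient.mk (orbitSetoid g) x⟩

theorem mk'_functor_obj (g : LinAut k C) (x : C) : mk' g (g.functor.obj x) = mk' g x :=
  congrArg ClassicalOrbit.mk (Quotient.sound (s := orbitSetoid g)
    ((orbitSetoid g).symm ⟨1, by unfold LinAut.act; rw [zpow_one]⟩))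

variable {g : LinAut k C}

/-- Morphisms `X ⟶ Y` are the families `(f_{v,u} ∈ C(u, v))_{u ∈ X, v ∈ Y}` with
`g(f_{v,u}) = f_{gv,gu}` that are row-finite and column-finite (which is automatic if `C` is locally
bounded).  Families are extended by `0` to all pairs of objects of `C`. -/
def homs (X Y : ClassicalOrbit g) : Submodule k (∀ u v : C, u ⟶ v) where
  carrier := {f | (∀ u v, f u v ≠ 0 → mk' g u = X ∧ mk' g v = Y) ∧
    (∀ u v, g.functor.map (f u v) = f (g.functor.obj u) (g.functor.obj v)) ∧
    (∀ u, {v | f u v ≠ 0}.Finite) ∧ (∀ v, {u | f u v ≠ 0}.Finite)}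
  zero_mem' := by
    refine ⟨fun u v h => absurd rfl h, fun u v => ?_, fun u => ?_, fun v => ?_⟩
    · simpa using g.map_smul (0 : k) (0 : u ⟶ v)
    · simp
    · simp
  add_mem' := by
    rintro f f' ⟨h1, h2, h3, h4⟩ ⟨h1', h2', h3', h4'⟩
    have H : ∀ u v, (f + f') u v ≠ 0 → f u v ≠ 0 ∨ f' u v ≠ 0 := by
      intro u v h
      by_contra! hc
      exact h (by simp [hc.1, hc.2])
    refine ⟨fun u v h => (H u v h).elim (h1 u v) (h1' u v), fun u v => ?_, fun u => ?_, fun v => ?_⟩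
    · simp [g.map_add, h2, h2']
    · exact ((h3 u).union (h3' u)).subset fun v h => H u v h
    · exact ((h4 v).union (h4' v)).subset fun u h => H u v h
  smul_mem' := by
    rintro c f ⟨h1, h2, h3, h4⟩
    have H : ∀ u v, (c • f) u v ≠ 0 → f u v ≠ 0 := by
      intro u v h hc
      exact h (by simp [hc])
    refine ⟨fun u v h => h1 u v (H u v h), fun u v => ?_, fun u => ?_, fun v => ?_⟩
    · simp [g.map_smul, h2]
    · exact (h3 u).subset fun v h => H u v h
    · exact (h4 v).subset fun u h => H u v h

/-- Matrix multiplication of families. -/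
def compFamily (f h : ∀ u v : C, u ⟶ v) : ∀ u v : C, u ⟶ v :=
  fun u z => ∑ᶠ v : C, f u v ≫ h v z

theorem compFamily_eq_sum (f h : ∀ u v : C, u ⟶ v) (u z : C) (s : Finset C)
    (hs : ∀ v, f u v ≠ 0 → v ∈ s) : compFamily f h u z = ∑ v ∈ s, f u v ≫ h v z := by
  refine finsum_eq_sum_of_support_subset _ fun v hv => hs v fun h0 => hv ?_
  simp [h0]

theorem compFamily_ne_zero {f h : ∀ u v : C, u ⟶ v} {u z : C} (H : compFamily f h u z ≠ 0) :
    ∃ v, f u v ≠ 0 ∧ h v z ≠ 0 := by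
  by_contra! hc
  refine H ((finsum_congr fun v => ?_).trans finsum_zero)
  by_cases h0 : f u v = 0
  · simp [h0]
  · simp [hc v h0]

/-- The object part of `g` as a bijection. -/
def objEquiv (g : LinAut k C) : C ≃ C where
  toFun := g.functor.obj
  invFun := g.inverse.obj
  left_inv x := Functor.congr_obj g.functor_inverse x
  right_inv x := Functor.congr_obj g.inverse_functor x

theorem compFamily_mem {X Y Z : ClassicalOrbit g} {f h : ∀ u v : C, u ⟶ v}
    (hf : f ∈ homs X Y) (hh : h ∈ homs Y Z) : compFamily f h ∈ homs X Z := by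
  obtain ⟨f1, f2, f3, f4⟩ := hf
  obtain ⟨h1, h2, h3, h4⟩ := hh
  refine ⟨fun u z H => ?_, fun u z => ?_, fun u => ?_, fun z => ?_⟩
  · obtain ⟨v, hv, hv'⟩ := compFamily_ne_zero H
    exact ⟨(f1 u v hv).1, (h1 v z hv').2⟩
  · let G : (u ⟶ z) →+ (g.functor.obj u ⟶ g.functor.obj z) :=
      AddMonoidHom.mk' (fun l => g.functor.map l) g.map_add
    change G (compFamily f h u z) = ∑ᶠ v, f (g.functor.obj u) v ≫ h v (g.functor.obj z)
    rw [compFamily_eq_sum f h u z (f3 u).toFinset (by simp), map_sum]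
    rw [← finsum_comp_equiv (objEquiv g)]
    rw [finsum_eq_sum_of_support_subset (s := (f3 u).toFinset)]
    · refine Finset.sum_congr rfl fun v _ => ?_
      change g.functor.map (f u v ≫ h v z) = _
      rw [Functor.map_comp, f2, h2]
      rfl
    · intro v hv
      rw [Set.Finite.coe_toFinset]
      intro h0
      apply hv
      change f (g.functor.obj u) (g.functor.obj v) ≫ h (g.functor.obj v) (g.functor.obj z) = 0
      rw [← f2, h0]
      have : g.functor.map (0 : u ⟶ v) = 0 := by simpa using g.map_smul (0 : k) (0 : u ⟶ v)
      rw [this, Limits.zero_comp]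
  · refine ((f3 u).biUnion fun v _ => h3 v).subset fun z H => ?_
    obtain ⟨v, hv, hv'⟩ := compFamily_ne_zero H
    exact Set.mem_biUnion (show v ∈ {v | f u v ≠ 0} from hv) hv'
  · refine ((h4 z).biUnion fun v _ => f4 v).subset fun u H => ?_
    obtain ⟨v, hv, hv'⟩ := compFamily_ne_zero H
    exact Set.mem_biUnion (show v ∈ {v | h v z ≠ 0} from hv') hv

open Classical in
/-- The identity of the orbit `X`. -/
def idFamily (X : ClassicalOrbit g) : ∀ u v : C, u ⟶ v :=
  fun u v => if e : u = v then (if mk' g u = X then eqToHom e else 0) else 0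

theorem idFamily_mem (X : ClassicalOrbit g) : idFamily X ∈ homs X X := by
  have H : ∀ u v, idFamily X u v ≠ 0 → u = v ∧ mk' g u = X := by
    intro u v h
    unfold idFamily at h
    split_ifs at h with e e' <;> simp_all
  refine ⟨fun u v h => ?_, fun u v => ?_, fun u => ?_, fun v => ?_⟩
  · obtain ⟨rfl, h'⟩ := H u v h
    exact ⟨h', h'⟩
  · have h0 : g.functor.map (0 : u ⟶ v) = 0 := by simpa using g.map_smul (0 : k) (0 : u ⟶ v)
    by_cases e : u = v
    · subst e
      by_cases e' : mk' g u = X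
      · simp [idFamily, mk'_functor_obj, e']
      · simp [idFamily, mk'_functor_obj, e', h0]
    · have e2 : g.functor.obj u ≠ g.functor.obj v := fun h => e ((objEquiv g).injective h)
      simp [idFamily, e, e2, h0]
  · exact (Set.finite_singleton u).subset fun v h => (H u v h).1.symm
  · exact (Set.finite_singleton v).subset fun u h => (H u v h).1

theorem id_compFamily {X Y : ClassicalOrbit g} {f : ∀ u v : C, u ⟶ v} (hf : f ∈ homs X Y) :
    compFamily (idFamily X) f = f := by
  funext u z
  rw [compFamily_eq_sum _ _ u z {u}]
  · by_cases e : mk' g u = X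
    · simp [idFamily, e]
    · have : f u z = 0 := by
        by_contra h
        exact e (hf.1 u z h).1
      simp [this]
  · intro v h
    by_contra hv
    have e : u ≠ v := fun e => hv (by simp [e])
    exact h (by simp [idFamily, e])

theorem compFamily_id {X Y : ClassicalOrbit g} {f : ∀ u v : C, u ⟶ v} (hf : f ∈ homs X Y) :
    compFamily f (idFamily Y) = f := by
  funext u z
  have : compFamily f (idFamily Y) u z = f u z ≫ idFamily Y z z := by
    refine finsum_eq_single _ z fun v hv => ?_
    simp [idFamily, hv]
  rw [this]
  by_cases e : mk' g z = Y
  · simp [idFamily, e]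
  · have : f u z = 0 := by
      by_contra h
      exact e (hf.1 u z h).2
    simp [this]

theorem compFamily_assoc {X Y Z W : ClassicalOrbit g} {f h l : ∀ u v : C, u ⟶ v}
    (hf : f ∈ homs X Y) (hh : h ∈ homs Y Z) (_ : l ∈ homs Z W) :
    compFamily (compFamily f h) l = compFamily f (compFamily h l) := by
  classical
  funext u t
  let s : Finset C := (hf.2.2.1 u).toFinset
  let s' : Finset C := s.biUnion fun v => (hh.2.2.1 v).toFinset
  have hs : ∀ v, f u v ≠ 0 → v ∈ s := by simp [s]
  have hs' : ∀ v ∈ s, ∀ z, h v z ≠ 0 → z ∈ s' := by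
    intro v hv z hz
    simp only [s', Finset.mem_biUnion]
    exact ⟨v, hv, by simpa using hz⟩
  rw [compFamily_eq_sum _ l u t s', compFamily_eq_sum f _ u t s hs]
  · have e1 : ∀ z ∈ s', compFamily f h u z ≫ l z t = ∑ v ∈ s, f u v ≫ h v z ≫ l z t := by
      intro z _
      rw [compFamily_eq_sum f h u z s hs, Preadditive.sum_comp]
      simp
    have e2 : ∀ v ∈ s, f u v ≫ compFamily h l v t = ∑ z ∈ s', f u v ≫ h v z ≫ l z t := by
      intro v hv
      rw [compFamily_eq_sum h l v t s' (hs' v hv), Preadditive.comp_sum]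
    rw [Finset.sum_congr rfl e1, Finset.sum_congr rfl e2, Finset.sum_comm]
  · intro z hz
    obtain ⟨v, hv, hv'⟩ := compFamily_ne_zero hz
    exact hs' v (hs v hv) z hv'

instance : Category (ClassicalOrbit g) where
  Hom X Y := homs X Y
  id X := ⟨idFamily X, idFamily_mem X⟩
  comp f h := ⟨compFamily f.1 h.1, compFamily_mem f.2 h.2⟩
  id_comp f := Subtype.ext (id_compFamily f.2)
  comp_id f := Subtype.ext (compFamily_id f.2)
  assoc f h l := Subtype.ext (compFamily_assoc f.2 h.2 l.2)

/-- The entry `f_{v,u}` of a morphism of the classical orbit category. -/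
def entry {X Y : ClassicalOrbit g} (f : X ⟶ Y) (u v : C) : u ⟶ v := f.1 u v

instance : Preadditive (ClassicalOrbit g) where
  homGroup X Y := inferInstanceAs (AddCommGroup (homs X Y))
  add_comp X Y Z f f' h := by
    apply Subtype.ext
    funext u z
    change compFamily (f.1 + f'.1) h.1 u z = compFamily f.1 h.1 u z + compFamily f'.1 h.1 u z
    simp only [compFamily, Pi.add_apply, Preadditive.add_comp]
    refine finsum_add_distrib ?_ ?_
    · exact (f.2.2.2.1 u).subset fun v hv h0 => hv (by simp [h0])
    · exact (f'.2.2.2.1 u).subset fun v hv h0 => hv (by simp [h0])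
  comp_add X Y Z f h h' := by
    apply Subtype.ext
    funext u z
    change compFamily f.1 (h.1 + h'.1) u z = compFamily f.1 h.1 u z + compFamily f.1 h'.1 u z
    simp only [compFamily, Pi.add_apply, Preadditive.comp_add]
    refine finsum_add_distrib ?_ ?_
    · exact (f.2.2.2.1 u).subset fun v hv h0 => hv (by simp [h0])
    · exact (f.2.2.2.1 u).subset fun v hv h0 => hv (by simp [h0])

instance : Linear k (ClassicalOrbit g) where
  homModule X Y := inferInstanceAs (Module k (homs X Y))
  smul_comp X Y Z c f h := by
    apply Subtype.ext
    funext u z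
    change compFamily (c • f.1) h.1 u z = c • compFamily f.1 h.1 u z
    simp only [compFamily, Pi.smul_apply, Linear.smul_comp]
    exact (smul_finsum c _).symm
  comp_smul X Y Z f c h := by
    apply Subtype.ext
    funext u z
    change compFamily f.1 (c • h.1) u z = c • compFamily f.1 h.1 u z
    simp only [compFamily, Pi.smul_apply, Linear.comp_smul]
    exact (smul_finsum c _).symm

/-- `T` contains exactly one object from every orbit. -/
def IsTransversal (g : LinAut k C) (T : Set C) : Prop :=
  ∀ X : ClassicalOrbit g, ∃! x : C, x ∈ T ∧ mk' g x = X

/-- The morphisms of degree `a` of the classical orbit category, with respect to the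
representatives in `T`: for `x, y ∈ T` these are the families with entries only at the pairs
`(gᶜ⁺ᵃ x, gᶜ y)`, so that they correspond to `C(gᵃ x, y)`. -/
def deg (T : Set C) (a : ℤ) (X Y : ClassicalOrbit g) : Submodule k (X ⟶ Y) where
  carrier := {f | ∀ x ∈ T, mk' g x = X → ∀ y ∈ T, mk' g y = Y → ∀ u v : C, entry f u v ≠ 0 →
    ∃ c : ℤ, u = (g.act (c + a)).obj x ∧ v = (g.act c).obj y}
  zero_mem' := fun x _ _ y _ _ u v h => absurd rfl h
  add_mem' := by
    intro f f' hf hf' x hx hX y hy hY u v h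
    by_cases h0 : entry f u v = 0
    · refine hf' x hx hX y hy hY u v fun h1 => h ?_
      change entry f u v + entry f' u v = 0
      rw [h0, h1, add_zero]
    · exact hf x hx hX y hy hY u v h0
  smul_mem' := by
    intro c f hf x hx hX y hy hY u v h
    refine hf x hx hX y hy hY u v fun h1 => h ?_
    change c • entry f u v = 0
    rw [h1, smul_zero]

end ClassicalOrbit

end Classical

end GME

end

open GME

namespace GME

/-! Since `A(x,x) = k`, the space `D A(x,x)` is spanned by one form `ω_x` (`endForm`). For `a ∈
A(y,x)` and `β ∈ D A(y,x)` both composites of `a` and `β` in `Â` are multiples by `β(a)`: of `ω_y`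
when `a` is applied before `β`, of `ω_x` when it is applied after. So the composition of `Â` encodes
the perfect pairing of `A(y,x)` with its dual, seen from both adjacent levels.

Extension (`Repetitive.exists_intertwiner`): the automorphism `T = ψ⁻¹φ` fixes the objects, hence
scales each `ω_x^{[j]}` by a unit `c_j(x)`. The recursion `ρ(x^{[j]}) = ρ(x^{[j+1]}) c_j(x)` with
`ρ(x^{[i]}) = ρ₀(x)` has exactly one solution. Because `T` respects the two composites,
nondegeneracy of the pairing carries the intertwining relation from level `j` to the dual maps
between levels `j` and `j+1`, from there to level `j+1`, and likewise downwards.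

Powers: by `exists_cocycle`, the function `ρ⁻¹` extends to a cocycle `σ_a` for the action of `φ` on
objects. The scalars `σ_a` intertwine `ψᵃ` with `φᵃ` (`exists_twistsPow`), and the cocycle identity
is exactly equivariance of `η_a = σ_a`. The inverse scalars give a strict inverse of the induced
functor, so it is an isomorphism, and thus an equivalence, for every `n`.

Classical orbits: automorphisms commute on objects with `x^{[i]} ↦ x^{[i+1]}`, since the target is
recognised categorically through a socle (`Repetitive.obj_succ`). Hence `φᵃ` shifts levels by `a n`,
and the action is free for `n ≠ 0`. On a free action `σ` is the coboundary of a function `τ`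
(`exists_coboundary`), and conjugating families by the diagonal matrix `τ` is the required
isomorphism. -/

/-- Every function on a set with a `ℤ`-action extends to a multiplicative `1`-cocycle. -/
theorem exists_cocycle {S G : Type*} [CommGroup G] (e : Equiv.Perm S) (s : S → G) :
    ∃ σ : ℤ → S → G, (∀ x, σ 1 x = s x) ∧
      ∀ (b a : ℤ) (x : S), σ (b + a) x = σ b ((e ^ a) x) * σ a x := by
  -- The skew product of `e` with `s`; the cocycle is read off from the second coordinate of its
  -- powers, which makes negative exponents automatic.
  let P : Equiv.Perm (S × G) :=
    { toFun := fun p => (e p.1, s p.1 * p.2)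
      invFun := fun p => (e.symm p.1, (s (e.symm p.1))⁻¹ * p.2)
      left_inv := fun p => by simp
      right_inv := fun p => by simp }
  -- Right translations of the `G`-coordinate commute with `P`, so `P ^ b` at `(y, t)` is determined
  -- by its value at `(y, 1)`; this yields the cocycle identity.
  let R (t : G) : Equiv.Perm (S × G) := (Equiv.refl S).prodCongr (Equiv.mulRight t)
  have hR : ∀ (a : ℤ) (t : G), (P ^ a) * R t = R t * P ^ a := fun a t =>
    (Commute.zpow_left (show P * R t = R t * P by
      ext p <;> simp [P, R, mul_assoc]) a)
  have h1 : ∀ (a : ℤ) (p : S × G), ((P ^ a) p).1 = (e ^ a) p.1 := by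
    intro a
    induction a using Int.induction_on with
    | zero => simp
    | succ a ih => intro p; rw [zpow_add_one, zpow_add_one, Equiv.Perm.mul_apply, ih]; rfl
    | pred a ih =>
      intro p
      rw [zpow_sub_one, zpow_sub_one, Equiv.Perm.mul_apply, ih]; rfl
  refine ⟨fun a x => ((P ^ a) (x, 1)).2, fun x => by simp [P], fun b a x => ?_⟩
  have h2 : (P ^ a) (x, 1) = R ((P ^ a) (x, 1)).2 ((e ^ a) x, 1) := by
    apply Prod.ext
    · simp [R, h1]
    · simp [R]
  have h3 := congrArg Prod.snd (Equiv.congr_fun (hR b ((P ^ a) (x, 1)).2) ((e ^ a) x, 1))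
  simp only [Equiv.Perm.mul_apply] at h3
  rw [← h2] at h3
  change ((P ^ (b + a)) (x, 1)).2 = _
  rw [zpow_add, Equiv.Perm.mul_apply, h3]
  rfl

/-! ### Automorphisms and a categorical description of socles -/

section Functors

variable {k : Type*} [Field k] {C : Type*} [Category C] [Preadditive C] [Linear k C]

namespace LinAut

theorem obj_surjective (g : LinAut k C) : Function.Surjective g.functor.obj :=
  fun Y => ⟨g.inverse.obj Y, Functor.congr_obj g.inverse_functor Y⟩

theorem obj_injective (g : LinAut k C) : Function.Injective g.functor.obj :=
  Function.LeftInverse.injective (g := g.inverse.obj) fun X => Functor.congr_obj g.functor_inverse X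

theorem map_surjective (g : LinAut k C) {x y : C} (f : g.functor.obj x ⟶ g.functor.obj y) :
    ∃ f₀ : x ⟶ y, g.functor.map f₀ = f := by
  have hx : g.inverse.obj (g.functor.obj x) = x := Functor.congr_obj g.functor_inverse x
  have hy : g.inverse.obj (g.functor.obj y) = y := Functor.congr_obj g.functor_inverse y
  refine ⟨eqToHom hx.symm ≫ g.inverse.map f ≫ eqToHom hy, ?_⟩
  have h := Functor.congr_hom g.inverse_functor f
  simp only [Functor.comp_map, Functor.id_map] at h
  simp [h, eqToHom_map]

theorem map_zero (g : LinAut k C) (x y : C) : g.functor.map (0 : x ⟶ y) = 0 := by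
  simpa using g.map_smul (0 : k) (0 : x ⟶ y)

end LinAut

/-- Some nonzero `f : X ⟶ Z` factors through every nonzero morphism out of `X`. -/
def IsSocleTarget {C : Type*} [Category C] [Preadditive C] (X Z : C) : Prop :=
  ∃ f : X ⟶ Z, f ≠ 0 ∧ ∀ ⦃Y : C⦄ (g : X ⟶ Y), g ≠ 0 → ∃ h : Y ⟶ Z, g ≫ h = f

/-- The condition mentions only composition and zero morphisms, and an automorphism is bijective on
objects and on morphisms. -/
theorem IsSocleTarget.map (g : LinAut k C) {X Z : C} (h : IsSocleTarget X Z) :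
    IsSocleTarget (g.functor.obj X) (g.functor.obj Z) := by
  obtain ⟨f, hf, H⟩ := h
  refine ⟨g.functor.map f, fun h0 => hf (g.map_injective (h0.trans (g.map_zero X Z).symm)), ?_⟩
  intro Y l hl
  obtain ⟨Y, rfl⟩ := g.obj_surjective Y
  obtain ⟨l, rfl⟩ := g.map_surjective l
  obtain ⟨m, hm⟩ := H l (fun h0 => hl (by rw [h0, g.map_zero]))
  exact ⟨g.functor.map m, by rw [← Functor.map_comp, hm]⟩

end Functors

/-! ### The repetitive category: pairing, socles and levels -/

namespace Repetitive

variable {k : Type*} [Field k] {A : Type*} [Category A] [Preadditive A] [Linear k A]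

theorem hom_ext {X Y : Repetitive k A} {f g : X ⟶ Y} (h₁ : f.1.1 = g.1.1) (h₂ : f.1.2 = g.1.2) :
    f = g :=
  Subtype.ext (Prod.ext h₁ h₂)

theorem comp_fst {X Y Z : Repetitive k A} (f : X ⟶ Y) (g : Y ⟶ Z) :
    (f ≫ g).1.1 = f.1.1 ≫ g.1.1 := rfl

theorem comp_snd_apply {X Y Z : Repetitive k A} (f : X ⟶ Y) (g : Y ⟶ Z) (b : Z.obj ⟶ X.obj) :
    (f ≫ g).1.2 b = g.1.2 (b ≫ f.1.1) + f.1.2 (g.1.1 ≫ b) := rfl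

theorem smul_fst {X Y : Repetitive k A} (c : k) (f : X ⟶ Y) : (c • f).1.1 = c • f.1.1 := rfl

/-- The morphism `β^{[i]} : x^{[i]} ⟶ y^{[i+1]}` given by `β ∈ D A(y, x)`. -/
def dualMap (i : ℤ) {x y : A} (β : Module.Dual k (y ⟶ x)) :
    (⟨x, i⟩ : Repetitive k A) ⟶ ⟨y, i + 1⟩ :=
  ⟨(0, β), ⟨fun _ => rfl, fun h => absurd rfl h⟩⟩

/-- The morphism `a^{[i]} : x^{[i]} ⟶ y^{[i]}` given by `a ∈ A(x, y)`. -/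
def levelMap (k : Type*) [Field k] [Linear k A] (i : ℤ) {x y : A} (a : x ⟶ y) :
    (⟨x, i⟩ : Repetitive k A) ⟶ ⟨y, i⟩ :=
  (incl k A i).map a

theorem exists_levelMap {i : ℤ} {x y : A} (f : (⟨x, i⟩ : Repetitive k A) ⟶ ⟨y, i⟩) :
    ∃ a : x ⟶ y, levelMap k i a = f :=
  ⟨f.1.1, hom_ext rfl (f.2.2 (by simp)).symm⟩

theorem exists_dualMap {i : ℤ} {x y : A} (f : (⟨x, i⟩ : Repetitive k A) ⟶ ⟨y, i + 1⟩) :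
    ∃ β : Module.Dual k (y ⟶ x), dualMap i β = f :=
  ⟨f.1.2, hom_ext (f.2.1 (by simp)).symm rfl⟩

theorem lvl_of_ne_zero {X Y : Repetitive k A} {f : X ⟶ Y} (hf : f ≠ 0) :
    Y.lvl = X.lvl ∨ Y.lvl = X.lvl + 1 := by
  by_contra! h
  exact hf (hom_ext (f.2.1 h.1) (f.2.2 h.2))

theorem smul_levelMap (i : ℤ) {x y : A} (c : k) (a : x ⟶ y) :
    c • levelMap k i a = levelMap k i (c • a) :=
  hom_ext rfl (smul_zero c)

theorem smul_dualMap (i : ℤ) {x y : A} (c : k) (β : Module.Dual k (y ⟶ x)) :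
    c • dualMap i β = dualMap i (c • β) :=
  hom_ext (smul_zero c) rfl

theorem levelMap_injective (i : ℤ) {x y : A} {a b : x ⟶ y}
    (h : levelMap k i a = levelMap k i b) : a = b :=
  congrArg (fun f => f.1.1) h

theorem dualMap_injective (i : ℤ) {x y : A} {a b : Module.Dual k (y ⟶ x)}
    (h : dualMap i a = dualMap i b) : a = b :=
  congrArg (fun f => f.1.2) h

/-- The linear form on `A(x, x) = k` with `c • 𝟙 x ↦ c`. -/
noncomputable def endForm (hcyc : NoNonzeroOrientedCycles k A) (x : A) : Module.Dual k (x ⟶ x) :=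
  ((LinearEquiv.ofBijective (LinearMap.toSpanSingleton k (x ⟶ x) (𝟙 x)) (hcyc x)).symm :
    (x ⟶ x) →ₗ[k] k)

theorem endForm_smul_id (hcyc : NoNonzeroOrientedCycles k A) (x : A) (b : x ⟶ x) :
    endForm hcyc x b • 𝟙 x = b :=
  (LinearEquiv.ofBijective (LinearMap.toSpanSingleton k (x ⟶ x) (𝟙 x)) (hcyc x)).apply_symm_apply b

theorem endForm_id (hcyc : NoNonzeroOrientedCycles k A) (x : A) : endForm hcyc x (𝟙 x) = 1 :=
  (hcyc x).1 (by simpa using endForm_smul_id hcyc x (𝟙 x))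

theorem dual_eq_smul_endForm (hcyc : NoNonzeroOrientedCycles k A) (x : A)
    (β : Module.Dual k (x ⟶ x)) :
    β = β (𝟙 x) • endForm hcyc x := by
  ext b
  conv_lhs => rw [← endForm_smul_id hcyc x b]
  simp [mul_comm]

theorem dualMap_endForm_ne_zero (hcyc : NoNonzeroOrientedCycles k A) (i : ℤ) (x : A) :
    dualMap i (endForm hcyc x) ≠ 0 := by
  intro h
  have := LinearMap.congr_fun (congrArg (fun f => f.1.2) h) (𝟙 x)
  change endForm hcyc x (𝟙 x) = 0 at this
  rw [endForm_id] at this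
  exact one_ne_zero this

/-- The composite lies in the line `D A(y,y)`, so it is determined by its value at `𝟙 y`, which is
`β a`. This and the next lemma express the evaluation pairing through composition, once with the
form of `y` and once with that of `x`. -/
theorem levelMap_comp_dualMap (hcyc : NoNonzeroOrientedCycles k A) (i : ℤ) {x y : A} (a : y ⟶ x)
    (β : Module.Dual k (y ⟶ x)) :
    levelMap k i a ≫ dualMap i β = β a • dualMap i (endForm hcyc y) := by
  rw [smul_dualMap]
  refine hom_ext ?_ ?_
  · exact Limits.comp_zero
  · refine (dual_eq_smul_endForm hcyc y _).trans ?_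
    rw [comp_snd_apply]
    change (β (𝟙 y ≫ a) + 0) • _ = β a • _
    rw [Category.id_comp, add_zero]

theorem dualMap_comp_levelMap (hcyc : NoNonzeroOrientedCycles k A) (i : ℤ) {x y : A} (a : y ⟶ x)
    (β : Module.Dual k (y ⟶ x)) :
    dualMap i β ≫ levelMap k (i + 1) a = β a • dualMap i (endForm hcyc x) := by
  rw [smul_dualMap]
  refine hom_ext ?_ ?_
  · exact Limits.zero_comp
  · refine (dual_eq_smul_endForm hcyc x _).trans ?_
    rw [comp_snd_apply]
    change (0 + β (a ≫ 𝟙 x)) • _ = β a • _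
    rw [Category.comp_id, zero_add]

theorem end_eq_smul_id (hcyc : NoNonzeroOrientedCycles k A) (X : Repetitive k A) (e : X ⟶ X) :
    ∃ c : k, e = c • 𝟙 X :=
  ⟨endForm hcyc X.obj e.1.1, hom_ext (endForm_smul_id hcyc X.obj e.1.1).symm
    ((e.2.2 (by simp)).trans (smul_zero _).symm)⟩

/-- The socle map is the form on `A(x,x)`. A nonzero morphism out of `x^{[i]}` is some `a` or some
`β`; nondegeneracy of the pairing supplies a partner with nonzero value, and rescaling it makes the
composite equal to that form. -/
theorem isSocleTarget_succ (hcyc : NoNonzeroOrientedCycles k A) (x : A) (i : ℤ) :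
    IsSocleTarget (⟨x, i⟩ : Repetitive k A) ⟨x, i + 1⟩ := by
  refine ⟨dualMap i (endForm hcyc x), dualMap_endForm_ne_zero hcyc i x, ?_⟩
  rintro ⟨y, j⟩ g hg
  rcases lvl_of_ne_zero hg with h | h <;> dsimp only at h <;> subst h
  · obtain ⟨a, rfl⟩ := exists_levelMap g
    have ha : a ≠ 0 := by
      intro h
      apply hg
      rw [h]
      exact hom_ext rfl rfl
    obtain ⟨β, hβ⟩ := Module.Projective.exists_dual_ne_zero k ha
    refine ⟨dualMap _ ((β a)⁻¹ • β), ?_⟩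
    rw [levelMap_comp_dualMap hcyc]
    simp [hβ]
  · obtain ⟨β, rfl⟩ := exists_dualMap g
    have hb : ∃ a, β a ≠ 0 := by
      by_contra! h
      apply hg
      exact hom_ext rfl (LinearMap.ext h)
    obtain ⟨a, ha⟩ := hb
    refine ⟨levelMap k (i + 1) ((β a)⁻¹ • a), ?_⟩
    rw [dualMap_comp_levelMap hcyc]
    simp [ha]

/-- The two socle maps factor through each other, and the comparison maps are mutually inverse
because endomorphisms in `Â` are scalars. An isomorphism in `Â` preserves the level and projects to
an isomorphism in `A`, where isomorphic objects are equal. -/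
theorem eq_of_isSocleTarget (hcyc : NoNonzeroOrientedCycles k A) (hA : IsLocallyBounded k A)
    {X Z W : Repetitive k A}
    (hZ : IsSocleTarget X Z) (hW : IsSocleTarget X W) : Z = W := by
  obtain ⟨f, hf, Hf⟩ := hZ
  obtain ⟨f', hf', Hf'⟩ := hW
  obtain ⟨l, hl⟩ := Hf f' hf'
  obtain ⟨m, hm⟩ := Hf' f hf
  have key : ∀ {V : Repetitive k A} {p : X ⟶ V} {e : V ⟶ V}, p ≠ 0 → p ≫ e = p → e = 𝟙 V := by
    intro V p e hp he
    obtain ⟨c, rfl⟩ := end_eq_smul_id hcyc V e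
    have h1 : (c - 1) • p = 0 := by
      rw [sub_smul, one_smul, sub_eq_zero]
      simpa using he
    have h2 : c = 1 := sub_eq_zero.1 ((smul_eq_zero.1 h1).resolve_right hp)
    rw [h2, one_smul]
  have e1 : l ≫ m = 𝟙 W := key hf' (by rw [reassoc_of% hl, hm])
  have e2 : m ≫ l = 𝟙 Z := key hf (by rw [reassoc_of% hm, hl])
  have hl0 : l ≠ 0 := by rintro rfl; exact hf (by rw [← hl, Limits.comp_zero])
  have hm0 : m ≠ 0 := by rintro rfl; exact hf' (by rw [← hm, Limits.comp_zero])
  have h1 := lvl_of_ne_zero hl0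
  have h2 := lvl_of_ne_zero hm0
  have h3 : Z.obj = W.obj := hA.eq_of_iso _ _ ⟨(proj k A).mapIso ⟨m, l, e2, e1⟩⟩
  obtain ⟨z, j⟩ := Z
  obtain ⟨w, j'⟩ := W
  dsimp only at h1 h2 h3
  obtain rfl : z = w := h3
  -- A nonzero morphism raises the level by 0 or 1; with nonzero morphisms both ways the levels
  -- agree.
  obtain rfl : j = j' := by omega
  rfl

/-- Both sides are socle targets of `φ(x^{[i]})`. A jump, which is prescribed at level 0 only, is
thereby propagated to all levels. -/
theorem obj_succ (hcyc : NoNonzeroOrientedCycles k A) (hA : IsLocallyBounded k A)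
    (φ : LinAut k (Repetitive k A)) (x : A) (i : ℤ) :
    φ.functor.obj ⟨x, i + 1⟩ =
      ⟨(φ.functor.obj ⟨x, i⟩).obj, (φ.functor.obj ⟨x, i⟩).lvl + 1⟩ :=
  eq_of_isSocleTarget hcyc hA ((isSocleTarget_succ hcyc x i).map φ) (isSocleTarget_succ hcyc _ _)

theorem lvl_obj (hcyc : NoNonzeroOrientedCycles k A) (hA : IsLocallyBounded k A)
    {φ : LinAut k (Repetitive k A)} {n : ℤ}
    (hφ : HasJump φ n) (X : Repetitive k A) : (φ.functor.obj X).lvl = X.lvl + n := by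
  obtain ⟨x, i⟩ := X
  have hs : ∀ j, (φ.functor.obj ⟨x, j + 1⟩).lvl = (φ.functor.obj ⟨x, j⟩).lvl + 1 := fun j =>
    congrArg Repetitive.lvl (obj_succ hcyc hA φ x j)
  induction i using Int.induction_on with
  | zero =>
    have h : φ.functor.obj ⟨x, 0⟩ ∈ φ.functor.obj '' {X | X.lvl = 0} := ⟨_, rfl, rfl⟩
    rw [hφ] at h
    simpa using h
  | succ i ih => rw [hs, ih]; dsimp only; omega
  | pred i ih =>
    have := hs (-(i : ℤ) - 1)
    rw [sub_add_cancel, ih] at this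
    dsimp only at this ⊢
    omega

/-- For `n ≠ 0` this makes the action on objects free. -/
theorem lvl_act_obj (hcyc : NoNonzeroOrientedCycles k A) (hA : IsLocallyBounded k A)
    {φ : LinAut k (Repetitive k A)} {n : ℤ}
    (hφ : HasJump φ n) (a : ℤ) (X : Repetitive k A) :
    ((φ.act a).obj X).lvl = X.lvl + a * n := by
  have h1 : ∀ X, (φ.act 1).obj X = φ.functor.obj X := fun X => by
    unfold LinAut.act; rw [zpow_one]
  induction a using Int.induction_on with
  | zero => simp [φ.act_zero_obj]
  | succ a ih => rw [add_comm, φ.act_add_obj, h1, lvl_obj hcyc hA hφ, ih]; ring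
  | pred a ih =>
    have h := lvl_obj hcyc hA hφ ((φ.act (-(a : ℤ) - 1)).obj X)
    rw [← h1, ← φ.act_add_obj, add_sub_cancel, ih] at h
    linarith

/-- Multiplicative extension of scalars: if an automorphism `T` that fixes the objects is given by
conjugation with scalars on one level, it is so everywhere. -/
theorem exists_intertwiner (hcyc : NoNonzeroOrientedCycles k A)
    (T : ∀ {X Y : Repetitive k A}, (X ⟶ Y) → (X ⟶ Y))
    (T_comp : ∀ {X Y Z : Repetitive k A} (f : X ⟶ Y) (g : Y ⟶ Z), T (f ≫ g) = T f ≫ T g)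
    (T_smul : ∀ {X Y : Repetitive k A} (c : k) (f : X ⟶ Y), T (c • f) = c • T f)
    (T_ne_zero : ∀ {X Y : Repetitive k A} {f : X ⟶ Y}, f ≠ 0 → T f ≠ 0)
    (ρ₀ : A → kˣ) (i : ℤ)
    (h₀ : ∀ {x y : A} (a : x ⟶ y),
      (ρ₀ y : k) • T (levelMap k i a) = (ρ₀ x : k) • levelMap k i a) :
    ∃ ρ : Repetitive k A → kˣ, (∀ x, ρ ⟨x, i⟩ = ρ₀ x) ∧
      ∀ {X Y : Repetitive k A} (f : X ⟶ Y), (ρ Y : k) • T f = (ρ X : k) • f := by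
  -- `T` maps the line `D A(x,x)` at level `j` to itself without killing it.
  have hc : ∀ (j : ℤ) (x : A), ∃ c : kˣ,
      T (dualMap j (endForm hcyc x)) = (c : k) • dualMap j (endForm hcyc x) := by
    intro j x
    obtain ⟨β, hβ⟩ := exists_dualMap (T (dualMap j (endForm hcyc x)))
    have h0 := T_ne_zero (dualMap_endForm_ne_zero hcyc j x)
    rw [← hβ, dual_eq_smul_endForm hcyc x β, ← smul_dualMap] at h0
    refine ⟨Units.mk0 (β (𝟙 x)) (fun h => h0 (by rw [h, zero_smul])), ?_⟩
    rw [← hβ, smul_dualMap, Units.val_mk0, ← dual_eq_smul_endForm hcyc x β]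
  choose c hc using hc
  -- The two-sided recursion along the levels is solved by a cocycle over the translation `j ↦ j +
  -- 1` of `ℤ` with values `c⁻¹`, normalised at the starting level `i`.
  have hR : ∀ x : A, ∃ r : ℤ → kˣ, r i = ρ₀ x ∧ ∀ j, r j = r (j + 1) * c j x := by
    intro x
    obtain ⟨σ, h1, h2⟩ := exists_cocycle (Equiv.addRight (1 : ℤ)) (fun j => (c j x)⁻¹)
    have hpow : ∀ a j : ℤ, ((Equiv.addRight (1 : ℤ)) ^ a : Equiv.Perm ℤ) j = j + a := by
      intro a
      induction a using Int.induction_on with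
      | zero => simp
      | succ a ih => intro j; rw [zpow_add_one, Equiv.Perm.mul_apply, ih, Equiv.coe_addRight]; ring
      | pred a ih =>
        intro j
        rw [zpow_sub_one, Equiv.Perm.mul_apply, ih]
        change j + -1 + -(a : ℤ) = _
        ring
    have h3 : σ 0 i = 1 := by
      have := h2 0 0 i
      simpa using this
    refine ⟨fun j => ρ₀ x * σ (j - i) i, by simp [h3], fun j => ?_⟩
    have h4 := h2 1 (j - i) i
    rw [hpow, h1, show i + (j - i) = j by ring] at h4
    change ρ₀ x * σ (j - i) i = ρ₀ x * σ (j + 1 - i) i * c j x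
    rw [show j + 1 - i = 1 + (j - i) by ring, h4, mul_comm (c j x)⁻¹]
    simp [mul_assoc]
  choose R hRi hR using hR
  have hR' : ∀ x j, (R x j : k) = R x (j + 1) * c j x := fun x j => by
    rw [hR x j, Units.val_mul]
  -- the two ways to evaluate `β` at `a`
  have left : ∀ {x y : A} {j : ℤ} {β β' : Module.Dual k (y ⟶ x)} {a a' : y ⟶ x},
      T (dualMap j β) = dualMap j β' → T (levelMap k j a) = levelMap k j a' →
      β' a' = β a * c j y := by
    intro x y j β β' a a' hβ ha
    have h := T_comp (levelMap k j a) (dualMap j β)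
    rw [levelMap_comp_dualMap hcyc, T_smul, hc, hβ, ha, levelMap_comp_dualMap hcyc, smul_smul] at h
    exact (smul_left_injective k (dualMap_endForm_ne_zero hcyc j y) h).symm
  have right : ∀ {x y : A} {j : ℤ} {β β' : Module.Dual k (y ⟶ x)} {a a' : y ⟶ x},
      T (dualMap j β) = dualMap j β' → T (levelMap k (j + 1) a) = levelMap k (j + 1) a' →
      β' a' = β a * c j x := by
    intro x y j β β' a a' hβ ha
    have h := T_comp (dualMap j β) (levelMap k (j + 1) a)
    rw [dualMap_comp_levelMap hcyc, T_smul, hc, hβ, ha, dualMap_comp_levelMap hcyc, smul_smul] at h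
    exact (smul_left_injective k (dualMap_endForm_ne_zero hcyc j x) h).symm
  -- `L j` is the intertwining relation inside level `j`, and `B j` is the one for the dual maps
  -- from level `j` to level `j + 1`. The four implications below link `L j`, `B j` and `L (j + 1)`.
  let L (j : ℤ) : Prop := ∀ {x y : A} (a : x ⟶ y),
    (R y j : k) • T (levelMap k j a) = (R x j : k) • levelMap k j a
  let B (j : ℤ) : Prop := ∀ {x y : A} (β : Module.Dual k (y ⟶ x)),
    (R y (j + 1) : k) • T (dualMap j β) = (R x j : k) • dualMap j β
  have eval_eq : ∀ {x y : A} {a b : x ⟶ y}, (∀ β : Module.Dual k (x ⟶ y), β a = β b) → a = b :=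
    fun h => (Module.forall_dual_apply_eq_zero_iff k _).1 (fun β => by rw [map_sub, h, sub_self])
      |> sub_eq_zero.1
  -- Apply the transformed form `β'` to the relation for `a`: the identity `β' a' = β a * c`
  -- converts it into a relation between the values of `β'` and `β` at `a`, and the recursion for
  -- `R` matches the scalars.
  have LB : ∀ j, L j → B j := by
    intro j hL x y β
    obtain ⟨β', hβ'⟩ := exists_dualMap (T (dualMap j β))
    rw [← hβ', smul_dualMap, smul_dualMap]
    congr 1
    ext a
    obtain ⟨a', ha'⟩ := exists_levelMap (T (levelMap k j a))
    have h1 := hL a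
    rw [← ha', smul_levelMap, smul_levelMap] at h1
    have h2 := congrArg β' (levelMap_injective j h1)
    have h3 := left hβ'.symm ha'.symm
    rw [map_smul, map_smul, h3] at h2
    simp only [smul_eq_mul, LinearMap.smul_apply] at h2 ⊢
    rw [hR' y] at h2
    refine mul_right_cancel₀ (c j y).ne_zero ?_
    linear_combination -h2
  have LB' : ∀ j, L (j + 1) → B j := by
    intro j hL x y β
    obtain ⟨β', hβ'⟩ := exists_dualMap (T (dualMap j β))
    rw [← hβ', smul_dualMap, smul_dualMap]
    congr 1
    ext a
    obtain ⟨a', ha'⟩ := exists_levelMap (T (levelMap k (j + 1) a))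
    have h1 := hL a
    rw [← ha', smul_levelMap, smul_levelMap] at h1
    have h2 := congrArg β' (levelMap_injective (j + 1) h1)
    have h3 := right hβ'.symm ha'.symm
    rw [map_smul, map_smul, h3] at h2
    simp only [smul_eq_mul, LinearMap.smul_apply] at h2 ⊢
    rw [hR' x]
    linear_combination -h2
  have BL : ∀ j, B j → L j := by
    intro j hB y x a
    obtain ⟨a', ha'⟩ := exists_levelMap (T (levelMap k j a))
    rw [← ha', smul_levelMap, smul_levelMap]
    congr 1
    refine eval_eq fun β => ?_
    obtain ⟨β', hβ'⟩ := exists_dualMap (T (dualMap j β))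
    have h1 := hB β
    rw [← hβ', smul_dualMap, smul_dualMap] at h1
    have h2 := LinearMap.congr_fun (dualMap_injective j h1) a'
    have h3 := left hβ'.symm ha'.symm
    simp only [LinearMap.smul_apply, h3, map_smul, smul_eq_mul] at h2 ⊢
    rw [hR' y]
    linear_combination -h2
  -- The dual argument: morphisms are compared through their values under all linear forms, now with
  -- the composite ending at level `j + 1`.
  have BL' : ∀ j, B j → L (j + 1) := by
    intro j hB y x a
    obtain ⟨a', ha'⟩ := exists_levelMap (T (levelMap k (j + 1) a))
    rw [← ha', smul_levelMap, smul_levelMap]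
    congr 1
    refine eval_eq fun β => ?_
    obtain ⟨β', hβ'⟩ := exists_dualMap (T (dualMap j β))
    have h1 := hB β
    rw [← hβ', smul_dualMap, smul_dualMap] at h1
    have h2 := LinearMap.congr_fun (dualMap_injective j h1) a'
    have h3 := right hβ'.symm ha'.symm
    simp only [LinearMap.smul_apply, h3, map_smul, smul_eq_mul] at h2 ⊢
    rw [hR' x] at h2
    refine mul_right_cancel₀ (c j x).ne_zero ?_
    linear_combination -h2
  have hL : ∀ j, L j := by
    intro j
    have : ∀ m : ℤ, L (i + m) := by
      intro m
      induction m using Int.induction_on with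
      | zero =>
        rw [add_zero]
        intro x y a
        rw [hRi, hRi]
        exact h₀ a
      | succ m ih => rw [← add_assoc]; exact BL' _ (LB _ ih)
      | pred m ih =>
        refine BL _ (LB' _ ?_)
        rwa [show i + (-(m : ℤ) - 1) + 1 = i + -(m : ℤ) by ring]
    have h : L (i + (j - i)) := this (j - i)
    rwa [add_sub_cancel] at h
  refine ⟨fun X => R X.obj X.lvl, hRi, ?_⟩
  rintro ⟨x, j⟩ ⟨y, l⟩ f
  -- Only nonzero morphisms force the levels to be equal or adjacent; the zero morphism between
  -- arbitrary levels needs its own case.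
  by_cases hf : f = 0
  · subst hf
    have h0 := T_smul 0 (0 : (⟨x, j⟩ : Repetitive k A) ⟶ ⟨y, l⟩)
    rw [zero_smul, zero_smul] at h0
    rw [h0, smul_zero, smul_zero]
  · rcases lvl_of_ne_zero hf with h | h <;> dsimp only at h <;> subst h
    · obtain ⟨a, rfl⟩ := exists_levelMap f
      exact hL _ a
    · obtain ⟨β, rfl⟩ := exists_dualMap f
      exact LB _ (hL _) β

end Repetitive

/-! ### Extension of the scalars from one level to the repetitive category -/

namespace Repetitive

variable {k : Type*} [Field k] {A : Type*} [Category A] [Preadditive A] [Linear k A]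

theorem exists_intertwines_extension (hA : IsLocallyBounded k A)
    (hcyc : NoNonzeroOrientedCycles k A) {n : ℤ} {φ ψ : LinAut k (Repetitive k A)}
    (hψ : HasJump ψ n) (hobj : ∀ X : Repetitive k A, φ.functor.obj X = ψ.functor.obj X) (i : ℤ)
    (ρ₀ : A → kˣ)
    (h : Intertwines (level φ i) (level ψ i) (fun x => congrArg Repetitive.obj (hobj ⟨x, i⟩)) ρ₀) :
    ∃ ρ : Repetitive k A → kˣ,
      (∀ x : A, ρ ⟨x, i⟩ = ρ₀ x) ∧ Intertwines φ.functor ψ.functor hobj ρ := by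
  -- `T` is `ψ⁻¹φ`, obtained by lifting along `ψ`, so that source and target of each morphism stay
  -- literally the same.
  have hT : ∀ (X Y : Repetitive k A) (f : X ⟶ Y), ∃ f' : X ⟶ Y,
      ψ.functor.map f' = eqToHom (hobj X).symm ≫ φ.functor.map f ≫ eqToHom (hobj Y) :=
    fun X Y f => ψ.map_surjective _
  choose T hT using hT
  obtain ⟨ρ, h1, h2⟩ := exists_intertwiner hcyc (fun {X Y} => T X Y)
    (fun f g => ψ.map_injective (by simp [hT]))
    (fun c f => ψ.map_injective (by simp [hT, φ.map_smul, ψ.map_smul]))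
    (fun {X Y f} hf h0 => hf <| φ.map_injective <| by
      have h3 := hT X Y f
      rw [h0, ψ.map_zero] at h3
      rw [φ.map_zero, ← cancel_epi (eqToHom (hobj X).symm), ← cancel_mono (eqToHom (hobj Y))]
      simpa using h3.symm)
    ρ₀ i (fun {x y} a => ψ.map_injective <| by
      rw [ψ.map_smul, ψ.map_smul, hT]
      -- The images of two objects of level `i` share a level, so the `D A`-components vanish and
      -- the relation in `Â` reduces to the given one in `A`.
      have hl : (ψ.functor.obj ⟨y, i⟩).lvl ≠ (ψ.functor.obj ⟨x, i⟩).lvl + 1 := by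
        rw [lvl_obj hcyc hA hψ, lvl_obj hcyc hA hψ]
        simp
      refine hom_ext ?_ ((Subtype.prop (p := (· ∈ homs _ _)) _).2 hl |>.trans
        ((Subtype.prop (p := (· ∈ homs _ _)) _).2 hl).symm)
      have h4 := h a
      have h5 : ∀ {X Y : Repetitive k A} (e : X = Y),
          (eqToHom e : X ⟶ Y).1.1 = eqToHom (congrArg Repetitive.obj e) := by
        rintro X _ rfl
        rfl
      rw [smul_fst, smul_fst, comp_fst, comp_fst, h5, h5]
      change (ρ₀ y : k) • (φ.functor.map (levelMap k i a)).1.1 =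
        eqToHom (congrArg Repetitive.obj (hobj ⟨x, i⟩)) ≫
          ((ρ₀ x : k) • (ψ.functor.map (levelMap k i a)).1.1) ≫
          eqToHom (congrArg Repetitive.obj (hobj ⟨y, i⟩)).symm at h4
      rw [← Linear.comp_smul, ← Linear.smul_comp, h4]
      simp)
  refine ⟨ρ, h1, fun X Y f => ?_⟩
  have h3 := congrArg (fun l => ψ.functor.map l) (h2 f)
  simp only [ψ.map_smul, hT] at h3
  rw [← h3]
  simp

end Repetitive

/-! ### Scalar intertwiners of the powers and the equivariance on the identity -/

section Twist

variable {k : Type*} [Field k] {C : Type*} [Category C] [Preadditive C] [Linear k C]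

theorem LinAut.act_one_obj (g : LinAut k C) (x : C) : (g.act 1).obj x = g.functor.obj x := by
  unfold LinAut.act; rw [zpow_one]

theorem LinAut.act_one_map (g : LinAut k C) {x y : C} (f : x ⟶ y) :
    (g.act 1).map f = eqToHom (g.act_one_obj x) ≫ g.functor.map f ≫
      eqToHom (g.act_one_obj y).symm := by
  refine Functor.congr_hom (F := g.act 1) (G := g.functor) ?_ f
  unfold LinAut.act; rw [zpow_one]

theorem LinAut.act_map_injective (g : LinAut k C) (a : ℤ) {x y : C} {f f' : x ⟶ y}
    (h : (g.act a).map f = (g.act a).map f') : f = f' :=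
  (g ^ a).map_injective h

theorem LinAut.act_add_map (g : LinAut k C) (b a : ℤ) {x y : C} (f : x ⟶ y) :
    (g.act (b + a)).map f = eqToHom (g.act_add_obj b a x) ≫ (g.act b).map ((g.act a).map f) ≫
      eqToHom (g.act_add_obj b a y).symm :=
  Functor.congr_hom (g.act_add b a) f

theorem LinAut.objEquiv_zpow (g : LinAut k C) (a : ℤ) (x : C) :
    (ClassicalOrbit.objEquiv g ^ a) x = (g.act a).obj x := by
  revert x
  induction a using Int.induction_on with
  | zero => intro x; simp [g.act_zero_obj]
  | succ a ih =>
    intro x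
    rw [zpow_add_one, Equiv.Perm.mul_apply, ih, g.act_add_obj, g.act_one_obj]
    rfl
  | pred a ih =>
    intro x
    rw [zpow_sub_one, Equiv.Perm.mul_apply, ih, sub_eq_add_neg, g.act_add_obj]
    unfold LinAut.act
    rw [zpow_neg_one]
    rfl

theorem LinAut.act_obj_eq {φ ψ : LinAut k C} (hobj : ∀ x, φ.functor.obj x = ψ.functor.obj x)
    (a : ℤ) (x : C) : (φ.act a).obj x = (ψ.act a).obj x := by
  rw [← φ.objEquiv_zpow, ← ψ.objEquiv_zpow,
    show ClassicalOrbit.objEquiv φ = ClassicalOrbit.objEquiv ψ from Equiv.ext hobj]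

variable {φ ψ : LinAut k C}

/-- The relation `σ_a(y) ψᵃ(f) = φᵃ(f) σ_a(x)`, for `φ` and `ψ` that coincide on objects. -/
def TwistsPow (hobj : ∀ x, φ.functor.obj x = ψ.functor.obj x) (σ : C → kˣ) (a : ℤ) : Prop :=
  ∀ ⦃x y : C⦄ (f : x ⟶ y), (σ y : k) • (ψ.act a).map f = (σ x : k) •
    (eqToHom (LinAut.act_obj_eq hobj a x).symm ≫ (φ.act a).map f ≫
      eqToHom (LinAut.act_obj_eq hobj a y))

theorem smul_map_eqToHom_conj {hobj : ∀ x, φ.functor.obj x = ψ.functor.obj x} {σ : C → kˣ} {b : ℤ}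
    (h : TwistsPow hobj σ b) {x x' y y' : C} (hx : x' = x) (hy : y = y') (f : x ⟶ y) :
    (σ y : k) • (ψ.act b).map (eqToHom hx ≫ f ≫ eqToHom hy) = (σ x : k) •
      (eqToHom (by rw [hx, LinAut.act_obj_eq hobj]) ≫ (φ.act b).map f ≫
        eqToHom (by rw [hy, LinAut.act_obj_eq hobj])) := by
  subst hx hy
  simpa using h f

/-- The relation for `b` rewrites `φᵇ` as `ψᵇ` up to scalars. After cancelling the unit `σb(φᵃ y)`,
the relation for `b + a` is the image under `ψᵇ` of the relation for `a`, and `ψᵇ` is faithful.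
Having both directions allows induction over negative exponents. -/
theorem twistsPow_add_iff {hobj : ∀ x, φ.functor.obj x = ψ.functor.obj x} {σb σa σ : C → kˣ}
    {b a : ℤ} (hb : TwistsPow hobj σb b) (hσ : ∀ x, σ x = σb ((φ.act a).obj x) * σa x) :
    TwistsPow hobj σ (b + a) ↔ TwistsPow hobj σa a := by
  refine forall_congr' fun x => forall_congr' fun y => forall_congr' fun f => ?_
  have K := smul_map_eqToHom_conj hb (LinAut.act_obj_eq hobj a x).symm (LinAut.act_obj_eq hobj a y)
    ((φ.act a).map f)
  have K' : eqToHom (LinAut.act_obj_eq hobj (b + a) x).symm ≫ (φ.act (b + a)).map f ≫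
      eqToHom (LinAut.act_obj_eq hobj (b + a) y) =
      eqToHom (ψ.act_add_obj b a x)
    ≫ (eqToHom (by rw [LinAut.act_obj_eq hobj, LinAut.act_obj_eq hobj]) ≫
        (φ.act b).map ((φ.act a).map f) ≫
        eqToHom (by rw [LinAut.act_obj_eq hobj, LinAut.act_obj_eq hobj])) ≫
          eqToHom (ψ.act_add_obj b a y).symm := by
    rw [φ.act_add_map]
    simp
  have e1 : (σ y : k) • (ψ.act (b + a)).map f = eqToHom (ψ.act_add_obj b a x) ≫
      ((σb ((φ.act a).obj y) : k) • (σa y : k) • (ψ.act b).map ((ψ.act a).map f)) ≫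
        eqToHom (ψ.act_add_obj b a y).symm := by
    rw [hσ, ψ.act_add_map]
    simp [smul_smul]
  have e2 : (σ x : k) • (eqToHom (LinAut.act_obj_eq hobj (b + a) x).symm ≫
      (φ.act (b + a)).map f ≫ eqToHom (LinAut.act_obj_eq hobj (b + a) y)) =
      eqToHom (ψ.act_add_obj b a x) ≫ ((σb ((φ.act a).obj y) : k) • (σa x : k) •
        (ψ.act b).map (eqToHom (LinAut.act_obj_eq hobj a x).symm ≫ (φ.act a).map f ≫
          eqToHom (LinAut.act_obj_eq hobj a y))) ≫ eqToHom (ψ.act_add_obj b a y).symm := by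
    rw [K', smul_comm (σb ((φ.act a).obj y) : k), K, hσ]
    simp [smul_smul, mul_comm]
  rw [e1, e2, cancel_epi, cancel_mono]
  constructor
  · intro h
    have h' := smul_right_injective _ (Units.ne_zero _) h
    rw [← Functor.map_smul (ψ.act b), ← Functor.map_smul (ψ.act b)] at h'
    exact ψ.act_map_injective b h'
  · intro h
    rw [← Functor.map_smul (ψ.act b), h, Functor.map_smul]

/-- A scalar intertwiner of `φ` and `ψ` gives intertwiners of all their powers. -/
theorem exists_twistsPow {hobj : ∀ x, φ.functor.obj x = ψ.functor.obj x} {ρ : C → kˣ}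
    (hρ : Intertwines φ.functor ψ.functor hobj ρ) :
    ∃ σ : ℤ → C → kˣ, (∀ x, σ 1 x = (ρ x)⁻¹) ∧ (∀ a, TwistsPow hobj (σ a) a) ∧
      ∀ (b a : ℤ) (x : C), σ (b + a) x = σ b ((φ.act a).obj x) * σ a x := by
  -- The inverse appears because `ρ` multiplies `φ` on the target side, whereas `η_a` goes from `ψᵃ`
  -- to `φᵃ`.
  obtain ⟨σ, h1, h2⟩ := exists_cocycle (ClassicalOrbit.objEquiv φ) (fun x => (ρ x)⁻¹)
  simp only [LinAut.objEquiv_zpow] at h2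
  have T1 : TwistsPow hobj (σ 1) 1 := by
    intro x y f
    have h := hρ f
    rw [h1, h1, φ.act_one_map, ψ.act_one_map]
    have h' : φ.functor.map f = ((ρ y)⁻¹ : kˣ).val •
        (eqToHom (hobj x) ≫ ((ρ x : k) • ψ.functor.map f) ≫ eqToHom (hobj y).symm) := by
      rw [← h, smul_smul]
      simp
    rw [h']
    have hx := (ρ x).ne_zero
    simp only [Units.val_inv_eq_inv_val, Linear.comp_smul, Linear.smul_comp, smul_smul]
    rw [show (ρ x : k)⁻¹ * ((ρ y : k)⁻¹ * ρ x) = (ρ y : k)⁻¹ by field_simp]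
    simp
  refine ⟨σ, h1, fun a => ?_, h2⟩
  induction a using Int.induction_on with
  -- Exponent 0 is reached by descending from exponent `1 = 1 + 0`.
  | zero => exact (twistsPow_add_iff T1 (h2 1 0)).1 (by rwa [add_zero])
  | succ a ih => rw [add_comm]; exact (twistsPow_add_iff T1 (h2 1 a)).2 ih
  | pred a ih =>
    exact (twistsPow_add_iff T1 (h2 1 (-(a : ℤ) - 1))).1
      (by rwa [add_sub_cancel])

section Equivariance

variable {hobj : ∀ x, φ.functor.obj x = ψ.functor.obj x} {σ : ℤ → C → kˣ}
  (hσ : ∀ a, TwistsPow hobj (σ a) a)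

/-- The natural isomorphism `ψᵃ ≅ φᵃ` given by scalars. -/
def scalarIso (a : ℤ) : 𝟭 C ⋙ ψ.act a ≅ φ.act a ⋙ 𝟭 C where
  hom :=
    { app := fun x => (σ a x : k) • eqToHom (LinAut.act_obj_eq hobj a x).symm
      naturality := fun x y f => by
        change (ψ.act a).map f ≫ _ = _ ≫ (φ.act a).map f
        have h := congrArg (fun l => l ≫ eqToHom (LinAut.act_obj_eq hobj a y).symm) (hσ a f)
        simpa using h }
  inv :=
    { app := fun x => ((σ a x)⁻¹ : kˣ).val • eqToHom (LinAut.act_obj_eq hobj a x)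
      naturality := fun x y f => by
        change (φ.act a).map f ≫ _ = _ ≫ (ψ.act a).map f
        have h := congrArg (fun l => ((σ a y)⁻¹ : kˣ).val • ((σ a x)⁻¹ : kˣ).val •
          (eqToHom (LinAut.act_obj_eq hobj a x) ≫ l)) (hσ a f)
        simp only [Linear.comp_smul, eqToHom_trans_assoc, eqToHom_refl, Category.id_comp] at h
        rw [smul_comm, smul_smul ((σ a y)⁻¹ : kˣ).val, smul_smul ((σ a x)⁻¹ : kˣ).val] at h
        simpa using h.symm }
  hom_inv_id := by ext x; simp [smul_smul]
  inv_hom_id := by ext x; simp [smul_smul]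

/-- The equivariance structure on the identity functor given by a scalar cocycle. -/
def scalarEquivariance
    (hadd : ∀ (b a : ℤ) (x : C), σ (b + a) x = σ b ((φ.act a).obj x) * σ a x) :
    Equivariance φ ψ (𝟭 C) where
  iso := scalarIso hσ
  iso_add b a x := by
    change (σ (b + a) x : k) • eqToHom _ = eqToHom _ ≫ (ψ.act b).map ((σ a x : k) • eqToHom _) ≫
      ((σ b ((φ.act a).obj x) : k) • eqToHom _) ≫ eqToHom _
    rw [hadd, Functor.map_smul, eqToHom_map]
    simp [smul_smul, mul_comm]

theorem TwistsPow.inv {τ : C → kˣ} {a : ℤ} (h : TwistsPow hobj τ a) :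
    TwistsPow (φ := ψ) (ψ := φ) (fun x => (hobj x).symm) (fun x => (τ x)⁻¹) a := by
  intro x y f
  have h' : (ψ.act a).map f = ((τ y)⁻¹ : kˣ).val • (τ x : k) •
    (eqToHom (LinAut.act_obj_eq hobj a x).symm ≫ (φ.act a).map f ≫
      eqToHom (LinAut.act_obj_eq hobj a y)) := by
    rw [← h f, smul_smul]
    simp
  rw [h']
  simp only [Linear.comp_smul, Linear.smul_comp, Category.assoc, eqToHom_trans, eqToHom_refl,
    Category.comp_id, eqToHom_trans_assoc, Category.id_comp]
  rw [smul_comm, smul_smul ((τ x)⁻¹ : kˣ).val]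
  simp

end Equivariance

end Twist

/-! ### Isomorphisms of graded categories and of orbit categories -/

section GrIso

namespace GrFunctor

variable {k : Type*} [Field k] {B : Type*} [Category B] [Preadditive B] [Linear k B]
  {B' : Type*} [Category B'] [Preadditive B'] [Linear k B']
  {𝒜 : Grading k B} {ℬ : Grading k B'}

theorem isomorphic_id (h : ∀ x : B, 𝟙 x ∈ 𝒜.deg 0 x x) :
    Isomorphic (GrFunctor.id 𝒜) (GrFunctor.id 𝒜) :=
  ⟨Iso.refl _, fun x => h x, fun x => h x⟩

theorem IsGrIsomorphism.isGrEquivalence {H : GrFunctor 𝒜 ℬ} (h : H.IsGrIsomorphism)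
    (h𝒜 : ∀ x : B, 𝟙 x ∈ 𝒜.deg 0 x x) (hℬ : ∀ x : B', 𝟙 x ∈ ℬ.deg 0 x x) :
    H.IsGrEquivalence := by
  obtain ⟨K, h1, h2⟩ := h
  exact ⟨K, by rw [h1]; exact isomorphic_id h𝒜, by rw [h2]; exact isomorphic_id hℬ⟩

theorem ext_of_adjuster {H I : GrFunctor 𝒜 ℬ} (h : H.functor = I.functor)
    (h' : H.adjuster = I.adjuster) : H = I := by
  cases H; cases I; cases h; cases h'; rfl

end GrFunctor

theorem OrbitCat.id_mem_grading_deg {k : Type*} [Field k] {C : Type*} [Category C] [Preadditive C]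
    [Linear k C] (g : LinAut k C) (X : OrbitCat g) : 𝟙 X ∈ (OrbitCat.grading g).deg 0 X X :=
  ⟨eqToHom (g.act_zero_obj X.as), rfl⟩

end GrIso

section ScalarOrbit

variable {k : Type*} [Field k] {C : Type*} [Category C] [Preadditive C] [Linear k C]
  {φ ψ : LinAut k C}

/-- On each homogeneous component the composite functor is precomposition with the product of the
two natural isomorphisms. -/
theorem Equivariance.orbitGrFunctor_comp_eq_id {η : Equivariance φ ψ (𝟭 C)}
    {η' : Equivariance ψ φ (𝟭 C)}
    (h : ∀ a x, (η'.iso a).hom.app x ≫ (η.iso a).hom.app x = 𝟙 ((φ.act a).obj x)) :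
    η.orbitGrFunctor.comp η'.orbitGrFunctor = GrFunctor.id (OrbitCat.grading φ) := by
  refine GrFunctor.ext_of_adjuster
    (CategoryTheory.Functor.hext (fun X => rfl) fun X Y f => heq_of_eq ?_) rfl
  change DirectSum.lmap (η'.orbitComponent X.as Y.as)
    (DirectSum.lmap (η.orbitComponent X.as Y.as) f) = f
  have e : DirectSum.lmap (η'.orbitComponent X.as Y.as) ∘ₗ
      DirectSum.lmap (η.orbitComponent X.as Y.as) = LinearMap.id := by
    apply DirectSum.linearMap_ext
    intro a
    refine LinearMap.ext fun l => ?_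
    simp only [LinearMap.comp_apply, LinearMap.id_apply]
    rw [DirectSum.lmap_lof, DirectSum.lmap_lof]
    refine congrArg (DirectSum.lof k ℤ (fun a => (φ.act a).obj X.as ⟶ Y.as) a) ?_
    change (η'.iso a).hom.app X.as ≫ (η.iso a).hom.app X.as ≫ l = l
    rw [← Category.assoc]
    exact (congrArg (· ≫ l) (h a X.as)).trans (Category.id_comp l)
  exact LinearMap.congr_fun e f

/-- The inverse scalars form a cocycle for `ψ`, because `k^×` is commutative and `φ`, `ψ` agree on
objects; they define the inverse functor. -/
theorem scalarEquivariance_isGrIsomorphism {hobj : ∀ x, φ.functor.obj x = ψ.functor.obj x}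
    {σ : ℤ → C → kˣ} (hσ : ∀ a, TwistsPow hobj (σ a) a)
    (hadd : ∀ (b a : ℤ) (x : C), σ (b + a) x = σ b ((φ.act a).obj x) * σ a x) :
    (scalarEquivariance hσ hadd).orbitGrFunctor.IsGrIsomorphism := by
  have hadd' : ∀ (b a : ℤ) (x : C),
      (σ (b + a) x)⁻¹ = (σ b ((ψ.act a).obj x))⁻¹ * (σ a x)⁻¹ := by
    intro b a x
    rw [hadd, LinAut.act_obj_eq hobj, mul_inv]
  let η' : Equivariance ψ φ (𝟭 C) :=
    scalarEquivariance (σ := fun a x => (σ a x)⁻¹) (fun a => (hσ a).inv) hadd'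
  refine ⟨η'.orbitGrFunctor, Equivariance.orbitGrFunctor_comp_eq_id fun a x => ?_,
    Equivariance.orbitGrFunctor_comp_eq_id fun a x => ?_⟩
  · change (((σ a x)⁻¹ : kˣ).val • eqToHom _) ≫ ((σ a x : k) • eqToHom _) = _
    simp [smul_smul]
  · change ((σ a x : k) • eqToHom _) ≫ (((σ a x)⁻¹ : kˣ).val • eqToHom _) = _
    simp [smul_smul]

end ScalarOrbit

/-! ### Gradings of classical orbit categories of free actions -/

namespace ClassicalOrbit

variable {k : Type*} [Field k] {C : Type*} [Category C] [Preadditive C] [Linear k C]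

section Grading

variable {g : LinAut k C}

theorem mk'_eq_iff {x y : C} : mk' g x = mk' g y ↔ ∃ m : ℤ, (g.act m).obj x = y := by
  constructor
  · intro h
    exact Quotient.exact (congrArg ClassicalOrbit.orbit h)
  · intro h
    exact congrArg ClassicalOrbit.mk (Quotient.sound h)

theorem act_obj_injective (hfree : ∀ (x : C) (m : ℤ), (g.act m).obj x = x → m = 0) {x : C}
    {a b : ℤ} (h : (g.act a).obj x = (g.act b).obj x) : a = b := by
  have h1 : (g.act (-b + a)).obj x = x := by
    rw [g.act_add_obj, h, ← g.act_add_obj, neg_add_cancel, g.act_zero_obj]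
  have := hfree x _ h1
  omega

theorem functor_obj_act_obj (c : ℤ) (x : C) :
    g.functor.obj ((g.act c).obj x) = (g.act (1 + c)).obj x := by
  rw [g.act_add_obj, g.act_one_obj]

theorem entry_functor_obj {X Y : ClassicalOrbit g} (f : X ⟶ Y) (u v : C) :
    entry f (g.functor.obj u) (g.functor.obj v) = g.functor.map (entry f u v) :=
  (f.2.2.1 u v).symm

theorem entry_functor_obj_eq_zero_iff {X Y : ClassicalOrbit g} (f : X ⟶ Y) (u v : C) :
    entry f (g.functor.obj u) (g.functor.obj v) = 0 ↔ entry f u v = 0 := by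
  rw [entry_functor_obj]
  exact ⟨fun h => g.map_injective (h.trans (g.map_zero u v).symm), fun h => by rw [h, g.map_zero]⟩

theorem entry_act_obj_eq_zero_iff {X Y : ClassicalOrbit g} (f : X ⟶ Y) (u v : C) (c : ℤ) :
    entry f ((g.act c).obj u) ((g.act c).obj v) = 0 ↔ entry f u v = 0 := by
  induction c using Int.induction_on with
  | zero => rw [g.act_zero_obj, g.act_zero_obj]
  | succ c ih =>
    rw [add_comm, ← functor_obj_act_obj, ← functor_obj_act_obj, entry_functor_obj_eq_zero_iff, ih]
  | pred c ih =>
    rw [← ih, ← entry_functor_obj_eq_zero_iff, functor_obj_act_obj, functor_obj_act_obj,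
      add_sub_cancel]

theorem hom_ext {X Y : ClassicalOrbit g} {f f' : X ⟶ Y} (h : ∀ u v, entry f u v = entry f' u v) :
    f = f' :=
  Subtype.ext (funext fun u => funext fun v => h u v)

/-- The entry at a pair of objects as a linear map. -/
def entryLinear (X Y : ClassicalOrbit g) (u v : C) : (X ⟶ Y) →ₗ[k] (u ⟶ v) where
  toFun f := entry f u v
  map_add' _ _ := rfl
  map_smul' _ _ := rfl

open Classical in
/-- The part of degree `a` of `f`, with respect to the representatives `x` and `y`. -/
noncomputable def part (x y : C) (a : ℤ) {X Y : ClassicalOrbit g} (f : X ⟶ Y) : X ⟶ Y :=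
  ⟨fun u v => if ∃ c : ℤ, u = (g.act (c + a)).obj x ∧ v = (g.act c).obj y then f.1 u v else 0, by
    have H : ∀ u v, (if ∃ c : ℤ, u = (g.act (c + a)).obj x ∧ v = (g.act c).obj y then f.1 u v
        else 0) ≠ 0 → f.1 u v ≠ 0 := by
      intro u v h
      split_ifs at h
      · exact h
      · exact absurd rfl h
    refine ⟨fun u v h => f.2.1 u v (H u v h), fun u v => ?_,
      fun u => (f.2.2.2.1 u).subset fun v h => H u v h,
      fun v => (f.2.2.2.2 v).subset fun u h => H u v h⟩
    have e : (∃ c : ℤ, g.functor.obj u = (g.act (c + a)).obj x ∧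
        g.functor.obj v = (g.act c).obj y) ↔
        ∃ c : ℤ, u = (g.act (c + a)).obj x ∧ v = (g.act c).obj y := by
      constructor
      · rintro ⟨c, h1, h2⟩
        refine ⟨c - 1, g.obj_injective ?_, g.obj_injective ?_⟩
        · rw [h1, functor_obj_act_obj]; congr 2; ring
        · rw [h2, functor_obj_act_obj]; congr 2; ring
      · rintro ⟨c, rfl, rfl⟩
        refine ⟨1 + c, ?_, functor_obj_act_obj _ _⟩
        rw [functor_obj_act_obj, add_assoc]
    beta_reduce
    by_cases h : ∃ c : ℤ, u = (g.act (c + a)).obj x ∧ v = (g.act c).obj y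
    · rw [if_pos h, if_pos (e.2 h)]
      exact f.2.2.1 u v
    · rw [if_neg h, if_neg (fun h' => h (e.1 h'))]
      exact g.map_zero u v⟩

theorem entry_part_act (x y : C) (a c : ℤ) {X Y : ClassicalOrbit g} (f : X ⟶ Y) :
    entry (part x y a f) ((g.act (c + a)).obj x) ((g.act c).obj y) =
      entry f ((g.act (c + a)).obj x) ((g.act c).obj y) :=
  if_pos ⟨c, rfl, rfl⟩

theorem exists_of_entry_part_ne_zero {x y : C} {a : ℤ} {X Y : ClassicalOrbit g} {f : X ⟶ Y}
    {u v : C} (h : entry (part x y a f) u v ≠ 0) :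
    (∃ c : ℤ, u = (g.act (c + a)).obj x ∧ v = (g.act c).obj y) ∧ entry f u v ≠ 0 := by
  unfold entry part at h
  dsimp only at h
  split_ifs at h with h1
  · exact ⟨h1, h⟩
  · exact absurd rfl h

theorem IsTransversal.mem_deg_iff {T : Set C} (hT : IsTransversal g T) {x y : C} (hx : x ∈ T)
    (hy : y ∈ T) {a : ℤ} {f : mk' g x ⟶ mk' g y} :
    f ∈ deg T a (mk' g x) (mk' g y) ↔
      ∀ u v, entry f u v ≠ 0 → ∃ c : ℤ, u = (g.act (c + a)).obj x ∧ v = (g.act c).obj y := by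
  constructor
  · intro h u v
    exact h x hx rfl y hy rfl u v
  · intro h x' hx' ex y' hy' ey u v
    obtain rfl := (hT (mk' g x)).unique ⟨hx', ex⟩ ⟨hx, rfl⟩
    obtain rfl := (hT (mk' g y)).unique ⟨hy', ey⟩ ⟨hy, rfl⟩
    exact h u v

/-- By freeness each pair in the product of the two orbits is `(g^{c+a} x, g^c y)` for unique `a`
and `c`, so a family splits according to `a`. -/
theorem deg_isInternal (hfree : ∀ (x : C) (m : ℤ), (g.act m).obj x = x → m = 0) {T : Set C}
    (hT : IsTransversal g T) (X Y : ClassicalOrbit g) :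
    DirectSum.IsInternal fun a => deg T a X Y := by
  classical
  obtain ⟨x, ⟨hx, rfl⟩, -⟩ := hT X
  obtain ⟨y, ⟨hy, rfl⟩, -⟩ := hT Y
  -- At a pair of offset `a` a sum of homogeneous families sees only its component of degree `a`; by
  -- linearity this is checked on one homogeneous family at a time.
  have entry_coe : ∀ (p : ⨁ a, deg T a (mk' g x) (mk' g y)) (a c : ℤ),
      entry (DirectSum.coeLinearMap (fun a => deg T a (mk' g x) (mk' g y)) p)
        ((g.act (c + a)).obj x) ((g.act c).obj y) =
      entry (p a).1 ((g.act (c + a)).obj x) ((g.act c).obj y) := by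
    intro p a c
    change entryLinear _ _ _ _ _ = entryLinear _ _ _ _ _
    induction p using DirectSum.induction_on with
    | zero => simp
    | add p q hp hq =>
      rw [map_add, map_add, hp, hq, ← map_add]
      rfl
    | of b q =>
      rw [← DirectSum.lof_eq_of k, DirectSum.coeLinearMap_lof]
      by_cases hb : b = a
      · subst hb
        rw [DirectSum.lof_apply]
      · have h1 : (DirectSum.lof k ℤ (fun a => deg T a (mk' g x) (mk' g y)) b q) a = 0 :=
          DirectSum.of_eq_of_ne _ _ _ (Ne.symm hb)
        rw [h1, ZeroMemClass.coe_zero, map_zero]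
        by_contra h
        obtain ⟨d, h2, h3⟩ := (hT.mem_deg_iff hx hy).1 q.2 _ _ h
        have h4 := act_obj_injective hfree h2
        have h5 := act_obj_injective hfree h3
        omega
  change Function.Bijective (DirectSum.coeLinearMap fun a => deg T a (mk' g x) (mk' g y))
  constructor
  · rw [← LinearMap.ker_eq_bot, LinearMap.ker_eq_bot']
    intro p hp
    refine DFinsupp.ext fun a => Subtype.ext (hom_ext fun u v => ?_)
    by_contra h
    obtain ⟨c, rfl, rfl⟩ := (hT.mem_deg_iff hx hy).1 (p a).2 u v h
    apply h
    rw [← entry_coe, hp]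
    rfl
  · intro f
    -- Column-finiteness at `y`, together with injectivity of `a ↦ gᵃ x`, leaves finitely many
    -- nonzero parts.
    have hfin : {a : ℤ | entry f ((g.act a).obj x) y ≠ 0}.Finite :=
      Set.Finite.preimage (f := fun a => (g.act a).obj x)
        (fun a _ b _ h => act_obj_injective hfree h) (f.2.2.2.2 y)
    have hmem : ∀ a, part x y a f ∈ deg T a (mk' g x) (mk' g y) := fun a =>
      (hT.mem_deg_iff hx hy).2 fun u v h => (exists_of_entry_part_ne_zero h).1
    refine ⟨∑ a ∈ hfin.toFinset, DirectSum.lof k ℤ (fun a => deg T a (mk' g x) (mk' g y)) a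
      ⟨part x y a f, hmem a⟩, ?_⟩
    rw [map_sum]
    simp only [DirectSum.coeLinearMap_lof]
    refine hom_ext fun u v => ?_
    change entryLinear _ _ u v _ = entryLinear _ _ u v f
    rw [map_sum]
    by_cases hf : entry f u v = 0
    · refine (Finset.sum_eq_zero fun a _ => ?_).trans hf.symm
      by_contra h
      exact (exists_of_entry_part_ne_zero h).2 hf
    · obtain ⟨hu, hv⟩ := f.2.1 u v hf
      obtain ⟨p, rfl⟩ := mk'_eq_iff.1 hu.symm
      obtain ⟨q, rfl⟩ := mk'_eq_iff.1 hv.symm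
      obtain ⟨a, rfl⟩ : ∃ a, p = q + a := ⟨p - q, by ring⟩
      rw [Finset.sum_eq_single a]
      · exact entry_part_act x y a q f
      · intro b _ hb
        by_contra h
        obtain ⟨⟨c, h1, h2⟩, -⟩ := exists_of_entry_part_ne_zero h
        have h3 := act_obj_injective hfree h1
        have h4 := act_obj_injective hfree h2
        omega
      · intro ha
        exfalso
        apply ha
        rw [Set.Finite.mem_toFinset]
        intro h0
        apply hf
        -- Equivariance moves the pair of offset `a` to the column of `y`, where the entry would
        -- vanish.
        rw [g.act_add_obj, entry_act_obj_eq_zero_iff, h0]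

/-- The `ℤ`-grading of the classical orbit category of a free action given by representatives. -/
noncomputable def transversalGrading (hfree : ∀ (x : C) (m : ℤ), (g.act m).obj x = x → m = 0)
    {T : Set C} (hT : IsTransversal g T) :
    Grading k (ClassicalOrbit g) where
  deg := deg T
  isInternal := deg_isInternal hfree hT
  comp_mem {X Y Z a b f h} hf hh := by
    obtain ⟨x, ⟨hx, rfl⟩, -⟩ := hT X
    obtain ⟨y, ⟨hy, rfl⟩, -⟩ := hT Y
    obtain ⟨z, ⟨hz, rfl⟩, -⟩ := hT Z
    rw [hT.mem_deg_iff hx hy] at hf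
    rw [hT.mem_deg_iff hy hz] at hh
    rw [hT.mem_deg_iff hx hz]
    intro u w hw
    obtain ⟨v, h1, h2⟩ := compFamily_ne_zero hw
    obtain ⟨c, rfl, rfl⟩ := hf u v h1
    obtain ⟨d, h3, rfl⟩ := hh _ w h2
    have h4 := act_obj_injective hfree h3
    exact ⟨d, by rw [h4, add_assoc], rfl⟩

end Grading

/-! ### Diagonal conjugation between classical orbit categories -/

section Diagonal

variable {φ ψ : LinAut k C} (hobj : ∀ x, φ.functor.obj x = ψ.functor.obj x)

/-- Automorphisms that coincide on objects have the same orbits. -/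
def orbitMap (X : ClassicalOrbit φ) : ClassicalOrbit ψ :=
  ⟨Quotient.map (sa := orbitSetoid φ) (sb := orbitSetoid ψ) id
    (by rintro x y ⟨m, h⟩; exact ⟨m, (LinAut.act_obj_eq hobj m x).symm.trans h⟩) X.orbit⟩

theorem exists_mk' {g : LinAut k C} (X : ClassicalOrbit g) : ∃ x, mk' g x = X := by
  obtain ⟨⟨x⟩⟩ := X
  exact ⟨x, rfl⟩

theorem orbitMap_orbitMap (X : ClassicalOrbit φ) :
    orbitMap (fun x => (hobj x).symm) (orbitMap hobj X) = X := by
  obtain ⟨x, rfl⟩ := exists_mk' X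
  rfl

theorem isTransversal_of_obj_eq (hobj : ∀ x, φ.functor.obj x = ψ.functor.obj x) {T : Set C}
    (hT : IsTransversal φ T) : IsTransversal ψ T := by
  intro X
  obtain ⟨x, rfl⟩ := exists_mk' X
  obtain ⟨t, ⟨h1, h2⟩, h3⟩ := hT (mk' φ x)
  refine ⟨t, ⟨h1, congrArg (orbitMap hobj) h2⟩, fun s hs => h3 s ⟨hs.1, ?_⟩⟩
  exact congrArg (orbitMap fun x => (hobj x).symm) hs.2

theorem family_congr {C : Type*} [Category C] (f : ∀ u v : C, u ⟶ v) {u u' v v' : C} (hu : u = u')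
    (hv : v = v') :
    f u v = eqToHom hu ≫ f u' v' ≫ eqToHom hv.symm := by
  subst hu hv
  simp

/-- Conjugation of a family of morphisms by scalars. -/
def diagFamily (τ : C → kˣ) (f : ∀ u v : C, u ⟶ v) : ∀ u v : C, u ⟶ v :=
  fun u v => ((τ u * (τ v)⁻¹ : kˣ) : k) • f u v

theorem diagFamily_ne_zero_iff {τ : C → kˣ} {f : ∀ u v : C, u ⟶ v} {u v : C} :
    diagFamily τ f u v ≠ 0 ↔ f u v ≠ 0 := by
  unfold diagFamily
  rw [Ne, smul_eq_zero]
  simp [Units.ne_zero]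

variable {hobj} {ρ τ : C → kˣ}

/-- Applying `ψ` instead of `φ` to the entry at `(u, v)` changes it by `ρ(v) ρ(u)⁻¹`. The condition
`τ(φ u) ρ(u) = τ(u)` absorbs this factor, which makes the conjugated family `ψ`-equivariant. -/
theorem diagFamily_mem (hρ : Intertwines φ.functor ψ.functor hobj ρ)
    (hτ : ∀ u, τ (φ.functor.obj u) * ρ u = τ u) {X Y : ClassicalOrbit φ} {f : ∀ u v : C, u ⟶ v}
    (hf : f ∈ homs X Y) : diagFamily τ f ∈ homs (orbitMap hobj X) (orbitMap hobj Y) := by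
  obtain ⟨f1, f2, f3, f4⟩ := hf
  refine ⟨fun u v h => ?_, fun u v => ?_, fun u => ?_, fun v => ?_⟩
  · obtain ⟨rfl, rfl⟩ := f1 u v (diagFamily_ne_zero_iff.1 h)
    exact ⟨rfl, rfl⟩
  · unfold diagFamily
    have h := hρ (f u v)
    rw [f2, family_congr f (hobj u) (hobj v)] at h
    replace h : (ρ v : k) • f (ψ.functor.obj u) (ψ.functor.obj v) =
        (ρ u : k) • ψ.functor.map (f u v) := by
      simpa using congrArg (fun l => eqToHom (hobj u).symm ≫ l ≫ eqToHom (hobj v)) h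
    have h' : f (ψ.functor.obj u) (ψ.functor.obj v) =
        ((ρ v)⁻¹ * ρ u : kˣ).val • ψ.functor.map (f u v) := by
      rw [Units.val_mul, mul_smul, ← h, smul_smul]
      simp
    rw [ψ.map_smul, h', smul_smul, ← Units.val_mul, ← hτ u, ← hτ v, hobj, hobj]
    congr 2
    rw [mul_inv]
    simp only [mul_assoc, mul_comm, mul_left_comm]
  · exact (f3 u).subset fun v h => diagFamily_ne_zero_iff.1 h
  · exact (f4 v).subset fun u h => diagFamily_ne_zero_iff.1 h

theorem diagFamily_compFamily (f h : ∀ u v : C, u ⟶ v) :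
    diagFamily τ (compFamily f h) = compFamily (diagFamily τ f) (diagFamily τ h) := by
  funext u w
  simp only [diagFamily, compFamily, smul_finsum]
  refine finsum_congr fun v => ?_
  rw [Linear.smul_comp, Linear.comp_smul, smul_smul, ← Units.val_mul]
  congr 2
  simp [mul_assoc]

theorem diagFamily_idFamily (X : ClassicalOrbit φ) :
    diagFamily τ (idFamily X) = idFamily (orbitMap hobj X) := by
  obtain ⟨x, rfl⟩ := exists_mk' X
  funext u v
  have e : mk' φ u = mk' φ x ↔ mk' ψ u = orbitMap hobj (mk' φ x) :=
    ⟨fun h => congrArg (orbitMap hobj) h, fun h => congrArg (orbitMap fun x => (hobj x).symm) h⟩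
  by_cases h : u = v
  · subst h
    by_cases h' : mk' φ u = mk' φ x
    · simp [diagFamily, idFamily, h', e.1 h']
    · simp [diagFamily, idFamily, h', mt e.2 h']
  · simp [diagFamily, idFamily, h]

/-- The functor between classical orbit categories given by conjugation with scalars. -/
def diagFunctor (hρ : Intertwines φ.functor ψ.functor hobj ρ)
    (hτ : ∀ u, τ (φ.functor.obj u) * ρ u = τ u) : ClassicalOrbit φ ⥤ ClassicalOrbit ψ where
  obj := orbitMap hobj
  map f := ⟨diagFamily τ f.1, diagFamily_mem hρ hτ f.2⟩
  map_id X := Subtype.ext (diagFamily_idFamily X)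
  map_comp f h := Subtype.ext (diagFamily_compFamily f.1 h.1)

/-- `diagFunctor` as a degree-preserving functor. -/
noncomputable def diagGrFunctor (hρ : Intertwines φ.functor ψ.functor hobj ρ)
    (hτ : ∀ u, τ (φ.functor.obj u) * ρ u = τ u)
    (hfree : ∀ (x : C) (m : ℤ), (φ.act m).obj x = x → m = 0)
    (hfree' : ∀ (x : C) (m : ℤ), (ψ.act m).obj x = x → m = 0)
    {T : Set C} (hT : IsTransversal φ T) (hT' : IsTransversal ψ T) :
    GrFunctor (transversalGrading hfree hT) (transversalGrading hfree' hT') where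
  functor := diagFunctor hρ hτ
  adjuster := fun _ => 0
  additive := ⟨fun {X Y f f'} => Subtype.ext (funext fun u => funext fun v => smul_add _ _ _)⟩
  linear := ⟨fun {X Y} f c => Subtype.ext (funext fun u => funext fun v => smul_comm _ _ _)⟩
  map_mem {X Y} a f hf := by
    rw [zero_add] at hf
    rw [add_zero]
    obtain ⟨x, ⟨hx, rfl⟩, -⟩ := hT X
    obtain ⟨y, ⟨hy, rfl⟩, -⟩ := hT Y
    refine (hT'.mem_deg_iff hx hy).2 fun u v h => ?_
    obtain ⟨c, h1, h2⟩ := (hT.mem_deg_iff hx hy).1 hf u v (diagFamily_ne_zero_iff.1 h)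
    exact ⟨c, by rw [h1, LinAut.act_obj_eq hobj], by rw [h2, LinAut.act_obj_eq hobj]⟩

theorem intertwines_symm (hρ : Intertwines φ.functor ψ.functor hobj ρ) :
    Intertwines ψ.functor φ.functor (fun x => (hobj x).symm) (fun x => (ρ x)⁻¹) := by
  intro x y f
  have h := hρ f
  have h' : φ.functor.map f = ((ρ y)⁻¹ : kˣ).val •
      (eqToHom (hobj x) ≫ ((ρ x : k) • ψ.functor.map f) ≫ eqToHom (hobj y).symm) := by
    rw [← h, smul_smul]
    simp
  rw [h']
  simp only [Linear.comp_smul, Linear.smul_comp, Category.assoc, eqToHom_trans, eqToHom_refl,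
    Category.comp_id, eqToHom_trans_assoc, Category.id_comp]
  rw [smul_comm, smul_smul ((ρ x)⁻¹ : kˣ).val]
  simp

/-- The round trip on orbits is the identity only propositionally, hence morphisms are compared
heterogeneously but entrywise. -/
theorem hom_heq {g : LinAut k C} {X X' Y Y' : ClassicalOrbit g} (hX : X = X') (hY : Y = Y')
    {f : X ⟶ Y} {f' : X' ⟶ Y'} (h : ∀ u v, entry f u v = entry f' u v) : HEq f f' := by
  subst hX hY
  exact heq_of_eq (hom_ext h)

theorem diagGrFunctor_comp (hρ : Intertwines φ.functor ψ.functor hobj ρ)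
    (hτ : ∀ u, τ (φ.functor.obj u) * ρ u = τ u) {ρ' τ' : C → kˣ}
    {hobj' : ∀ x, ψ.functor.obj x = φ.functor.obj x}
    (hρ' : Intertwines ψ.functor φ.functor hobj' ρ')
    (hτ' : ∀ u, τ' (ψ.functor.obj u) * ρ' u = τ' u) (hττ' : ∀ u, τ' u * τ u = 1)
    (hfree : ∀ (x : C) (m : ℤ), (φ.act m).obj x = x → m = 0)
    (hfree' : ∀ (x : C) (m : ℤ), (ψ.act m).obj x = x → m = 0)
    {T : Set C} (hT : IsTransversal φ T) (hT' : IsTransversal ψ T) :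
    (diagGrFunctor hρ hτ hfree hfree' hT hT').comp (diagGrFunctor hρ' hτ' hfree' hfree hT' hT) =
      GrFunctor.id (transversalGrading hfree hT) := by
  refine GrFunctor.ext_of_adjuster (CategoryTheory.Functor.hext (fun X => orbitMap_orbitMap hobj X)
    fun X Y f => hom_heq (orbitMap_orbitMap hobj X) (orbitMap_orbitMap hobj Y) fun u v => ?_) rfl
  change diagFamily τ' (diagFamily τ f.1) u v = f.1 u v
  unfold diagFamily
  rw [smul_smul, ← Units.val_mul, mul_mul_mul_comm, hττ', ← mul_inv, hττ']
  simp

theorem diagGrFunctor_isGrIsomorphism (hρ : Intertwines φ.functor ψ.functor hobj ρ)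
    (hτ : ∀ u, τ (φ.functor.obj u) * ρ u = τ u)
    (hfree : ∀ (x : C) (m : ℤ), (φ.act m).obj x = x → m = 0)
    (hfree' : ∀ (x : C) (m : ℤ), (ψ.act m).obj x = x → m = 0)
    {T : Set C} (hT : IsTransversal φ T) (hT' : IsTransversal ψ T) :
    (diagGrFunctor hρ hτ hfree hfree' hT hT').IsGrIsomorphism := by
  have hρ' := intertwines_symm hρ
  have hτ' : ∀ u, (τ (ψ.functor.obj u))⁻¹ * (ρ u)⁻¹ = (τ u)⁻¹ := by
    intro u
    rw [← hτ u, hobj, mul_inv]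
  exact ⟨diagGrFunctor (τ := fun u => (τ u)⁻¹) hρ' hτ' hfree' hfree hT' hT,
    diagGrFunctor_comp _ _ _ _ (by simp) _ _ _ _, diagGrFunctor_comp _ _ _ _ (by simp) _ _ _ _⟩

/-- A cocycle becomes a coboundary on a free action. -/
theorem exists_coboundary (hfree : ∀ (x : C) (m : ℤ), (φ.act m).obj x = x → m = 0) {T : Set C}
    (hT : IsTransversal φ T) {σ : ℤ → C → kˣ}
    (hadd : ∀ (b a : ℤ) (x : C), σ (b + a) x = σ b ((φ.act a).obj x) * σ a x) :
    ∃ τ : C → kˣ, (∀ x ∈ T, ∀ a, τ ((φ.act a).obj x) = σ a x) ∧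
      ∀ u, τ (φ.functor.obj u) = σ 1 u * τ u := by
  -- Write `u = φᵐ t` with `t ∈ T` and set `τ(u) = σ_m(t)`; freeness makes `m` unique.
  have h : ∀ u : C, ∃ p : C × ℤ, p.1 ∈ T ∧ (φ.act p.2).obj p.1 = u := by
    intro u
    obtain ⟨t, ⟨h1, h2⟩, -⟩ := hT (mk' φ u)
    obtain ⟨m, hm⟩ := mk'_eq_iff.1 h2
    exact ⟨(t, m), h1, hm⟩
  choose p hp hp' using h
  have key : ∀ x ∈ T, ∀ a, σ (p ((φ.act a).obj x)).2 (p ((φ.act a).obj x)).1 = σ a x := by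
    intro x hx a
    have h1 := hp' ((φ.act a).obj x)
    have h2 : (p ((φ.act a).obj x)).1 = x := by
      refine (hT (mk' φ x)).unique ⟨hp _, ?_⟩ ⟨hx, rfl⟩
      exact (mk'_eq_iff.2 ⟨_, h1⟩).trans (mk'_eq_iff.2 ⟨a, rfl⟩).symm
    rw [h2] at h1 ⊢
    rw [act_obj_injective hfree h1]
  refine ⟨fun u => σ (p u).2 (p u).1, key, fun u => ?_⟩
  -- Applying `φ` raises the exponent by 1, and the cocycle identity splits off `σ 1 u`.
  have h1 := key (p u).1 (hp u) (1 + (p u).2)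
  rw [← functor_obj_act_obj, hadd, hp' u] at h1
  exact h1

end Diagonal

end ClassicalOrbit

end GME

/-! ### Assembly of the main theorem -/

theorem theorem4p1 {k : Type*} [Field k] {A : Type*} [Category A] [Preadditive A] [Linear k A]
    (hA : IsLocallyBounded k A) (hcyc : NoNonzeroOrientedCycles k A)
    (n : ℤ) (φ ψ : LinAut k (Repetitive k A))
    (hφ : Repetitive.HasJump φ n) (hψ : Repetitive.HasJump ψ n)
    (hobj : ∀ X : Repetitive k A, φ.functor.obj X = ψ.functor.obj X) (i : ℤ) :
    (∀ ρ₀ : A → kˣ,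
      Intertwines (Repetitive.level φ i) (Repetitive.level ψ i)
        (fun x => congrArg Repetitive.obj (hobj ⟨x, i⟩)) ρ₀ →
      ∃ ρ : Repetitive k A → kˣ,
        (∀ x : A, ρ ⟨x, i⟩ = ρ₀ x) ∧ Intertwines φ.functor ψ.functor hobj ρ) ∧
    ((∃ ρ₀ : A → kˣ,
      Intertwines (Repetitive.level φ i) (Repetitive.level ψ i)
        (fun x => congrArg Repetitive.obj (hobj ⟨x, i⟩)) ρ₀) →
      ∃ η : Equivariance φ ψ (𝟭 (Repetitive k A)),
        η.orbitGrFunctor.IsGrEquivalence ∧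
        (n ≠ 0 →
          η.orbitGrFunctor.IsGrIsomorphism ∧
          ∀ T : Set (Repetitive k A), ClassicalOrbit.IsTransversal φ T →
            ∃ (𝒢φ : Grading k (ClassicalOrbit φ)) (𝒢ψ : Grading k (ClassicalOrbit ψ))
              (H : GrFunctor 𝒢φ 𝒢ψ),
              𝒢φ.deg = ClassicalOrbit.deg T ∧ 𝒢ψ.deg = ClassicalOrbit.deg T ∧
              H.IsGrIsomorphism ∧ (∀ X, H.adjuster X = 0) ∧
              (∀ x, H.functor.obj (ClassicalOrbit.mk' φ x) = ClassicalOrbit.mk' ψ x) ∧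
              ∀ x ∈ T, ∀ y ∈ T,
                ∀ (f : ClassicalOrbit.mk' φ x ⟶ ClassicalOrbit.mk' φ y) (a : ℤ),
                  ClassicalOrbit.entry (H.functor.map f) ((ψ.act a).obj x) y =
                    (η.iso a).hom.app x ≫ ClassicalOrbit.entry f ((φ.act a).obj x) y)) := by
  refine ⟨fun ρ₀ h => Repetitive.exists_intertwines_extension hA hcyc hψ hobj i ρ₀ h, ?_⟩
  rintro ⟨ρ₀, h⟩
  obtain ⟨ρ, -, hρ⟩ := Repetitive.exists_intertwines_extension hA hcyc hψ hobj i ρ₀ h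
  obtain ⟨σ, h1, hσ, hadd⟩ := exists_twistsPow hρ
  have hiso := scalarEquivariance_isGrIsomorphism hσ hadd
  refine ⟨scalarEquivariance hσ hadd, hiso.isGrEquivalence (OrbitCat.id_mem_grading_deg φ)
    (OrbitCat.id_mem_grading_deg ψ), fun hn => ⟨hiso, fun T hT => ?_⟩⟩
  -- A fixed point of `gᵐ` has its level shifted by `m n`, so `m n = 0`.
  have free : ∀ g : LinAut k (Repetitive k A), Repetitive.HasJump g n →
      ∀ (X : Repetitive k A) (m : ℤ), (g.act m).obj X = X → m = 0 := by
    intro g hg X m hm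
    have h2 := Repetitive.lvl_act_obj hcyc hA hg m X
    rw [hm, left_eq_add] at h2
    exact (mul_eq_zero.1 h2).resolve_right hn
  have hfree := free φ hφ
  have hfree' := free ψ hψ
  have hT' := ClassicalOrbit.isTransversal_of_obj_eq hobj hT
  obtain ⟨τ, hτ, hτ1⟩ := ClassicalOrbit.exists_coboundary hfree hT hadd
  -- This is the coboundary relation `τ(φ u) = σ₁(u) τ(u)` with `σ₁ = ρ⁻¹`, in the form needed for
  -- diagonal conjugation.
  have hτρ : ∀ u, τ (φ.functor.obj u) * ρ u = τ u := by
    intro u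
    rw [hτ1, h1, mul_comm (ρ u)⁻¹, inv_mul_cancel_right]
  refine ⟨ClassicalOrbit.transversalGrading hfree hT, ClassicalOrbit.transversalGrading hfree' hT',
    ClassicalOrbit.diagGrFunctor hρ hτρ hfree hfree' hT hT', rfl, rfl,
    ClassicalOrbit.diagGrFunctor_isGrIsomorphism hρ hτρ hfree hfree' hT hT', fun _ => rfl,
    fun _ => rfl, fun x hx y hy f a => ?_⟩
  -- Since `τ` is normalised to 1 on `T` and equals `σ_a(x)` at `φᵃ x`, the conjugating scalar at
  -- this entry is exactly the one in `η_a`.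
  change ((τ ((ψ.act a).obj x) * (τ y)⁻¹ : kˣ) : k) •
    ClassicalOrbit.entry f ((ψ.act a).obj x) y =
      ((σ a x : k) • eqToHom (LinAut.act_obj_eq hobj a x).symm) ≫
        ClassicalOrbit.entry f ((φ.act a).obj x) y
  have hσ0 : σ 0 y = 1 := by
    have := hadd 0 0 y
    rwa [φ.act_zero_obj, add_zero, left_eq_mul] at this
  have hy1 : τ y = 1 := by
    have := hτ y hy 0
    rwa [φ.act_zero_obj, hσ0] at this
  have hτa : τ ((ψ.act a).obj x) = σ a x := by
    rw [← LinAut.act_obj_eq hobj]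
    exact hτ x hx a
  have hf : ClassicalOrbit.entry f ((ψ.act a).obj x) y =
      eqToHom (LinAut.act_obj_eq hobj a x).symm ≫ ClassicalOrbit.entry f ((φ.act a).obj x) y := by
    have h2 := ClassicalOrbit.family_congr f.1 (LinAut.act_obj_eq hobj a x).symm (rfl : y = y)
    rwa [eqToHom_refl, Category.comp_id] at h2
  rw [hy1, hτa, hf]
  simp
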